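/- Let $\mathfrak{sl}_2$ be the Lie algebra of traceless complex $2\times 2$ matrices with standard basis $e,f,h$, where $e=E_{12}$, $f=E_{21}$, $h=E_{11}-E_{22}$. Let \[ \mathcal{L}^{\mathrm{tw}}:=\{z\in \mathbb{C}[t,t^{-1}]\otimes\mathfrak{sl}_2 \mid \theta(z)=z\},\qquad \theta(t^n\otimes x)=t^{-n}\otimes x, \] with the bracket $[P\otimes x,Q\otimes y]=PQ\otimes[x,y]$; this is the twisted loop algebra of the second kind of $(\mathfrak{sl}_2,\mathrm{id})$. Set \[ \mathcal{L}^{\mathrm{tw},+}:=\mathcal{L}^{\mathrm{tw}}\cap(\mathbb{C}[t,t^{-1}]\otimes\mathbb{C}e),\qquad \mathcal{L}^{\mathrm{tw},0}:=\mathcal{L}^{\mathrm{tw}}\cap(\mathbb{C}[t,t^{-1}]\otimes\mathbb{C}h), \] and $w_a:=(t+t^{-1})^a\otimes h\in\mathcal{L}^{\mathrm{tw},0}$ for each integer $a\ge 0$ (with $(t+t^{-1})^0=1$). Let $U^{\mathrm{tw}}$ be the universal enveloping algebra of $\mathcal{L}^{\mathrm{tw}}$. For a linear functional $\phi:\mathcal{L}^{\mathrm{tw},0}\to\mathbb{C}$,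 let \[ M(\phi):=U^{\mathrm{tw}}\Big/\Big(U^{\mathrm{tw}}\mathcal{L}^{\mathrm{tw},+}+\sum_{w\in\mathcal{L}^{\mathrm{tw},0}}U^{\mathrm{tw}}(w-\phi(w))\Big) \] be the universal highest weight module of highest weight $\phi$, and let $V(\phi)$ be its unique simple quotient, that is, the quotient of $M(\phi)$ by the sum of all its proper submodules. Then, for each $\phi\in\operatorname{Hom}_{\mathbb{C}}(\mathcal{L}^{\mathrm{tw},0},\mathbb{C})$, the following are equivalent: 1. $\dim_{\mathbb{C}}V(\phi)<\infty$. 2. There exist an integer $n\ge 0$ and $\alpha_1,\dots,\alpha_n\in\mathbb{C}^\times$ such that \[ \phi(w_a)=\sum_{i=1}^n(\alpha_i+\alpha_i^{-1})^a\quad\text{for all integers }a\ge 0, \] where $0^0=1$. -/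

import Mathlib

open scoped TensorProduct LaurentPolynomial

noncomputable section

namespace TwistedLoop

/-! ### Twisted loop algebras of the second kind -/

section General

variable (g : Type*) [LieRing g] [LieAlgebra ℂ g]

/-- The loop algebra `ℂ[t,t⁻¹] ⊗ g`, with bracket `[P ⊗ x, Q ⊗ y] = PQ ⊗ [x,y]`. -/
abbrev Loop : Type _ := ℂ[T;T⁻¹] ⊗[ℂ] g

variable {g}

/-- The extension of an automorphism `θ` of `g` (with `θ² = id`) to the loop algebra,
`t^n ⊗ x ↦ t^(-n) ⊗ θ x`. -/
def extend (θ : g ≃ₗ⁅ℂ⁆ g) : Loop g →ₗ⁅ℂ⁆ Loop g :=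
  LieAlgebra.ExtendScalars.map
    (LaurentPolynomial.invert : ℂ[T;T⁻¹] ≃ₐ[ℂ] ℂ[T;T⁻¹]).toAlgHom θ.toLieHom

theorem extend_tmul (θ : g ≃ₗ⁅ℂ⁆ g) (P : ℂ[T;T⁻¹]) (x : g) :
    extend θ (P ⊗ₜ[ℂ] x) = LaurentPolynomial.invert P ⊗ₜ[ℂ] θ x := rfl

/-- The twisted loop algebra of the second kind: the fixed points of `θ` in the loop algebra. -/
def twisted (θ : g ≃ₗ⁅ℂ⁆ g) : LieSubalgebra ℂ (Loop g) where
  carrier := {z | extend θ z = z}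
  add_mem' := by
    intro a b ha hb
    simp only [Set.mem_ofPred_eq] at ha hb ⊢
    rw [map_add, ha, hb]
  zero_mem' := map_zero _
  smul_mem' := by
    intro c a ha
    simp only [Set.mem_ofPred_eq] at ha ⊢
    rw [map_smul, ha]
  lie_mem' := by
    intro a b ha hb
    simp only [Set.mem_ofPred_eq] at ha hb
    change extend θ ⁅a, b⁆ = ⁅a, b⁆
    rw [LieHom.map_lie, ha, hb]

/-- For a subspace `n` of `g`, the subspace of the twisted loop algebra given by its intersection
with `ℂ[t,t⁻¹] ⊗ n`. -/
def twistedPart (θ : g ≃ₗ⁅ℂ⁆ g) (n : Submodule ℂ g) : Submodule ℂ (twisted θ) :=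
  (LinearMap.range (LinearMap.lTensor ℂ[T;T⁻¹] n.subtype)).comap (twisted θ).toSubmodule.subtype

end General

/-! ### Highest weight modules -/

section HighestWeight

variable {A : Type*} [LieRing A] [LieAlgebra ℂ A]

/-- The left ideal of the universal enveloping algebra of `A` generated by the positive part `P`
and by all elements `w - φ w`, for `w` in the zero part `Z`. -/
def highestWeightIdeal (P Z : Submodule ℂ A) (φ : Module.Dual ℂ Z) :
    Submodule (UniversalEnvelopingAlgebra ℂ A) (UniversalEnvelopingAlgebra ℂ A) :=
  Submodule.span (UniversalEnvelopingAlgebra ℂ A)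
    ({u | ∃ x ∈ P, u = UniversalEnvelopingAlgebra.ι ℂ x} ∪
      {u | ∃ w : Z, u = UniversalEnvelopingAlgebra.ι ℂ (w : A) -
        algebraMap ℂ (UniversalEnvelopingAlgebra ℂ A) (φ w)})

/-- The universal highest weight module `M(φ)`. -/
abbrev Universal (P Z : Submodule ℂ A) (φ : Module.Dual ℂ Z) : Type _ :=
  UniversalEnvelopingAlgebra ℂ A ⧸ highestWeightIdeal P Z φ

/-- The maximal proper submodule of `M(φ)`: the sum of all proper submodules. -/
def maximalSubmodule (P Z : Submodule ℂ A) (φ : Module.Dual ℂ Z) :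
    Submodule (UniversalEnvelopingAlgebra ℂ A) (Universal P Z φ) :=
  sSup {N | N ≠ ⊤}

/-- The quotient of `M(φ)` by its maximal proper submodule, that is, the unique simple quotient
`V(φ)` of `M(φ)`. -/
abbrev Simple (P Z : Submodule ℂ A) (φ : Module.Dual ℂ Z) : Type _ :=
  Universal P Z φ ⧸ maximalSubmodule P Z φ

end HighestWeight

/-! ### Type `A₁` with trivial automorphism -/

/-- The Lie algebra `sl₂` over `ℂ`. -/
abbrev sl2 : Type := LieAlgebra.SpecialLinear.sl (Fin 2) ℂ

/-- The Chevalley generator `e` of `sl₂`. -/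
def e : sl2 := LieAlgebra.SpecialLinear.single 0 1 (by decide) 1

/-- The Chevalley generator `h` of `sl₂`. -/
def h : sl2 := LieAlgebra.SpecialLinear.singleSubSingle 0 1 1

/-- The twisted loop algebra of the second kind of `(sl₂, id)`. -/
abbrev Ltw : LieSubalgebra ℂ (Loop sl2) := twisted (LieEquiv.refl : sl2 ≃ₗ⁅ℂ⁆ sl2)

/-- The positive part, the intersection of `Ltw` with `ℂ[t,t⁻¹] ⊗ ℂe`. -/
def LtwPos : Submodule ℂ Ltw := twistedPart LieEquiv.refl (Submodule.span ℂ {e})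

/-- The zero part, the intersection of `Ltw` with `ℂ[t,t⁻¹] ⊗ ℂh`. -/
def LtwZero : Submodule ℂ Ltw := twistedPart LieEquiv.refl (Submodule.span ℂ {h})

/-- The Laurent polynomial `t + t⁻¹`. -/
def tPlus : ℂ[T;T⁻¹] := LaurentPolynomial.T 1 + LaurentPolynomial.T (-1)

theorem invert_tPlus_pow (a : ℕ) : LaurentPolynomial.invert (tPlus ^ a) = tPlus ^ a := by
  rw [map_pow, tPlus, map_add, LaurentPolynomial.invert_T, LaurentPolynomial.invert_T, neg_neg,
    add_comm]

/-- The element `w_a = (t + t⁻¹)^a ⊗ h` of the zero part. -/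
def w (a : ℕ) : LtwZero :=
  ⟨⟨(tPlus ^ a) ⊗ₜ[ℂ] h, by
      change extend LieEquiv.refl ((tPlus ^ a) ⊗ₜ[ℂ] h) = (tPlus ^ a) ⊗ₜ[ℂ] h
      rw [extend_tmul, invert_tPlus_pow]
      rfl⟩,
    ⟨(tPlus ^ a) ⊗ₜ[ℂ] ⟨h, Submodule.mem_span_singleton_self h⟩, rfl⟩⟩

/-- The irreducible highest weight module `V(φ)` over `Ltw`. -/
abbrev V (φ : Module.Dual ℂ LtwZero) : Type := Simple LtwPos LtwZero φ

end TwistedLoop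

end

/-! The Laurent polynomials fixed by `t ↦ t⁻¹` are the polynomials in `X = t + t⁻¹`, so `Ltw` is
spanned by the elements `cur x p`, which multiply as in the current algebra `ℂ[X] ⊗ sl₂`, and `w a`
is `X ^ a ⊗ h`. Since every complex number has the form `α + α⁻¹`, condition 2 says that `φ` is a
sum of evaluations of polynomials at points of `ℂ`.

If `V(φ)` is finite-dimensional, some nonzero `g` has `F g = 0`, and then the ideal `(g)` acts by
zero. For `p` nilpotent modulo `g`, the operator `H p` has `φ p` as its only generalized eigenvalue;
being a commutator it has trace zero, so `φ p = 0` (`eq_zero_of_pow`). Hence `φ` depends only on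
values at the roots of `g`. An idempotent modulo `g` supported at one root gives an `sl₂`-triple, so
`φ` takes a natural number on it (`exists_nat`). Together: `exists_eq_sum_eval`.

This needs the highest weight vector of `V(φ)` to be nonzero. Instead of a PBW theorem,
`Verma.action` realizes `R ⊗ sl₂` by differential operators on a polynomial ring; the constant
coefficient there yields a functional on `M(φ)` that vanishes on every proper submodule but not on
the generator (`vacuum_notMem_maximalSubmodule`).

Conversely, the tensor product of the natural modules evaluated at the `α i` has a vector of weight
`φ`, and `V(φ)` is a quotient of the image of `M(φ)` in it (`finiteDimensional_simple`). -/

noncomputable section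

/-! ### Finite-dimensional highest weight representations of the current algebra -/

namespace TwistedLoop

open Polynomial

/-- A representation of the current algebra `ℂ[X] ⊗ sl₂`, given by the operators by which
`p ⊗ e`, `p ⊗ f` and `p ⊗ h` act. -/
structure CurrentRep (V : Type*) [AddCommGroup V] [Module ℂ V] where
  E : ℂ[X] →ₗ[ℂ] Module.End ℂ V
  F : ℂ[X] →ₗ[ℂ] Module.End ℂ V
  H : ℂ[X] →ₗ[ℂ] Module.End ℂ V
  E_mul_F : ∀ p q, E p * F q = F q * E p + H (p * q)
  H_mul_E : ∀ p q, H p * E q = E q * H p + (2 : ℂ) • E (p * q)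
  H_mul_F : ∀ p q, H p * F q = F q * H p + (-2 : ℂ) • F (p * q)
  H_mul_H : ∀ p q, H p * H q = H q * H p

namespace CurrentRep

variable {V : Type*} [AddCommGroup V] [Module ℂ V]

section Eigenspace

/-- If `A` commutes with a sequence of operators up to a shift, and the sequence terminates,
then the operators preserve the generalized eigenspaces of `A`. -/
theorem mem_maxGenEigenspace_of_shift (A : Module.End ℂ V) (μ c : ℂ) (Y : ℕ → Module.End ℂ V)
    (hY : ∀ j, A * Y j = Y j * A + c • Y (j + 1)) (N : ℕ) (hN : ∀ j, N ≤ j → Y j = 0)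
    (j : ℕ) {u : V} (hu : u ∈ A.maxGenEigenspace μ) : Y j u ∈ A.maxGenEigenspace μ := by
  have back : ∀ x : V, (A - μ • 1) x ∈ A.maxGenEigenspace μ → x ∈ A.maxGenEigenspace μ := by
    intro x hx
    rw [Module.End.mem_maxGenEigenspace] at hx ⊢
    obtain ⟨k, hk⟩ := hx
    exact ⟨k + 1, by rw [pow_succ, Module.End.mul_apply, hk]⟩
  rw [Module.End.mem_maxGenEigenspace] at hu
  obtain ⟨k, hk⟩ := hu
  induction k generalizing u j with
  | zero =>
    have : u = 0 := by simpa using hk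
    simp [this]
  | succ k ih =>
    -- Inner induction on the distance from `j` to `N`: in `(A - μ) Y_j u = Y_j (A - μ) u + c
    -- Y_{j+1} u` the first term has smaller `k` and the second is closer to the vanishing range.
    obtain ⟨d, hd⟩ : ∃ d, N ≤ j + d := ⟨N, by omega⟩
    induction d generalizing j with
    | zero => rw [hN j (by omega)]; simp
    | succ d ihd =>
      apply back
      have h1 : (A - μ • 1) (Y j u) = Y j ((A - μ • 1) u) + c • Y (j + 1) u := by
        have := congrArg (fun B => B u) (hY j)
        simp only [Module.End.mul_apply, LinearMap.add_apply, LinearMap.smul_apply] at this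
        simp only [LinearMap.sub_apply, LinearMap.smul_apply, Module.End.one_apply, map_sub,
          map_smul, this]
        abel
      rw [h1]
      refine add_mem (ih j ?_) (Submodule.smul_mem _ _ (ihd (j + 1) (by omega)))
      rw [← Module.End.mul_apply, ← pow_succ, hk]

end Eigenspace

variable (ρ : CurrentRep V)

theorem H_eq (p : ℂ[X]) : ρ.H p = ρ.E 1 * ρ.F p - ρ.F p * ρ.E 1 := by
  rw [ρ.E_mul_F, one_mul]; abel

theorem E_smul (p q : ℂ[X]) : (2 : ℂ) • ρ.E (p * q) = ρ.H p * ρ.E q - ρ.E q * ρ.H p := by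
  rw [ρ.H_mul_E]; abel

theorem F_smul (p q : ℂ[X]) : (-2 : ℂ) • ρ.F (p * q) = ρ.H p * ρ.F q - ρ.F q * ρ.H p := by
  rw [ρ.H_mul_F]; abel

/-- Brackets with `E q`, with `H q`, and then of `H (q * g)` with `E 1` spread the vanishing of `F
g` to the whole ideal `(g)`, in this and the next two lemmas. -/
theorem H_mul_eq_zero {g : ℂ[X]} (hg : ρ.F g = 0) (q : ℂ[X]) : ρ.H (q * g) = 0 := by
  have := ρ.E_mul_F q g
  simpa [hg] using this.symm

theorem F_mul_eq_zero {g : ℂ[X]} (hg : ρ.F g = 0) (q : ℂ[X]) : ρ.F (q * g) = 0 := by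
  have := ρ.F_smul q g
  simpa [hg] using this

theorem E_mul_eq_zero {g : ℂ[X]} (hg : ρ.F g = 0) (q : ℂ[X]) : ρ.E (q * g) = 0 := by
  have := ρ.E_smul (q * g) 1
  simpa [ρ.H_mul_eq_zero hg] using this

theorem exists_F_eq_zero [FiniteDimensional ℂ V] : ∃ g : ℂ[X], g ≠ 0 ∧ ρ.F g = 0 := by
  by_contra! hcon
  have hinj : Function.Injective ρ.F := by
    rw [injective_iff_map_eq_zero]
    intro a ha
    by_contra h
    exact hcon a h ha
  have := Module.Finite.of_injective ρ.F hinj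
  exact Polynomial.not_finite this

variable {ρ}

/-- A highest weight vector generating the representation. -/
structure IsHighestWeight (ρ : CurrentRep V) (v : V) (φ : ℂ[X] →ₗ[ℂ] ℂ) : Prop where
  ne_zero : v ≠ 0
  E_apply : ∀ p, ρ.E p v = 0
  H_apply : ∀ p, ρ.H p v = φ p • v
  cyclic : ∀ W : Submodule ℂ V, v ∈ W →
    (∀ p, ∀ u ∈ W, ρ.E p u ∈ W ∧ ρ.F p u ∈ W ∧ ρ.H p u ∈ W) → W = ⊤

variable {v : V} {φ : ℂ[X] →ₗ[ℂ] ℂ}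

/-- As `p` is nilpotent modulo `g`, the sequences `E (p ^ j * r)` and `F (p ^ j * r)` vanish for `j
≥ m`. The generalized eigenspace is therefore stable under the algebra, and it contains the cyclic
vector. -/
theorem IsHighestWeight.maxGenEigenspace_eq_top (hv : ρ.IsHighestWeight v φ)
    {g p q : ℂ[X]} (hg : ρ.F g = 0) {m : ℕ} (hp : p ^ m = q * g) :
    (ρ.H p).maxGenEigenspace (φ p) = ⊤ := by
  have hpow : ∀ j, m ≤ j → ∀ r : ℂ[X], p ^ j * r = (p ^ (j - m) * r * q) * g := by
    intro j hj r
    calc p ^ j * r = p ^ (j - m) * p ^ m * r := by rw [← pow_add, Nat.sub_add_cancel hj]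
      _ = _ := by rw [hp]; ring
  apply hv.cyclic
  · rw [Module.End.mem_maxGenEigenspace]
    exact ⟨1, by simp [hv.H_apply]⟩
  · intro r u hu
    refine ⟨?_, ?_, ?_⟩
    · have := mem_maxGenEigenspace_of_shift (ρ.H p) (φ p) 2 (fun j => ρ.E (p ^ j * r))
        (fun j => by rw [ρ.H_mul_E, pow_succ', mul_assoc]) m
        (fun j hj => by rw [hpow j hj, ρ.E_mul_eq_zero hg]) 0 hu
      simpa using this
    · have := mem_maxGenEigenspace_of_shift (ρ.H p) (φ p) (-2) (fun j => ρ.F (p ^ j * r))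
        (fun j => by rw [ρ.H_mul_F, pow_succ', mul_assoc]) m
        (fun j hj => by rw [hpow j hj, ρ.F_mul_eq_zero hg]) 0 hu
      simpa using this
    · exact Module.End.mapsTo_maxGenEigenspace_of_comm (ρ.H_mul_H p r) (φ p) hu

theorem IsHighestWeight.eq_zero_of_pow [FiniteDimensional ℂ V] (hv : ρ.IsHighestWeight v φ)
    {g p q : ℂ[X]} (hg : ρ.F g = 0) {m : ℕ} (hp : p ^ m = q * g) : φ p = 0 := by
  have htop := hv.maxGenEigenspace_eq_top hg hp
  have hnil : IsNilpotent (ρ.H p - φ p • 1) := by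
    rw [Module.End.maxGenEigenspace_eq, Module.End.genEigenspace_nat, LinearMap.ker_eq_top] at htop
    exact ⟨_, htop⟩
  have htr := (LinearMap.isNilpotent_trace_of_isNilpotent hnil).eq_zero
  have hnt : Nontrivial V := ⟨v, 0, hv.ne_zero⟩
  -- `H p` is the commutator of `E 1` and `F p`, so its trace is zero and only `φ p * dim V = 0`
  -- remains.
  rw [map_sub, ρ.H_eq, map_sub, LinearMap.trace_mul_comm, sub_self, map_smul, LinearMap.trace_one,
    zero_sub, neg_eq_zero, smul_eq_mul, mul_eq_zero] at htr
  rcases htr with h | h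
  · exact h
  · exact absurd h (by exact_mod_cast (Module.finrank_pos (R := ℂ) (M := V)).ne')

attribute [local instance] LieRing.ofAssociativeRing in
theorem IsHighestWeight.exists_nat [FiniteDimensional ℂ V] (hv : ρ.IsHighestWeight v φ)
    {g r ε : ℂ[X]} (hg : ρ.F g = 0) (hε : ε * ε = ε + r * g) : ∃ n : ℕ, φ ε = n := by
  -- `IsSl2Triple` requires a nonzero `h`, so this case is treated apart.
  by_cases h0 : ρ.H ε = 0
  · refine ⟨0, ?_⟩
    have := hv.H_apply ε
    rw [h0] at this
    simpa [hv.ne_zero] using this.symm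
  have hEε : ρ.E (ε * ε) = ρ.E ε := by rw [hε, map_add, ρ.E_mul_eq_zero hg, add_zero]
  have hFε : ρ.F (ε * ε) = ρ.F ε := by rw [hε, map_add, ρ.F_mul_eq_zero hg, add_zero]
  have hHε : ρ.H (ε * ε) = ρ.H ε := by rw [hε, map_add, ρ.H_mul_eq_zero hg, add_zero]
  have t : IsSl2Triple (ρ.H ε) (ρ.E ε) (ρ.F ε) :=
    { h_ne_zero := h0
      lie_e_f := by rw [LieRing.of_associative_ring_bracket, ρ.E_mul_F, hHε]; abel
      lie_h_e_nsmul := by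
        rw [LieRing.of_associative_ring_bracket, ρ.H_mul_E, hEε, two_smul, two_smul]; abel
      lie_h_f_nsmul := by
        rw [LieRing.of_associative_ring_bracket, ρ.H_mul_F, hFε, neg_smul, two_smul, two_smul]
        abel }
  have P : t.HasPrimitiveVectorWith v (φ ε) :=
    { ne_zero := hv.ne_zero
      lie_h := hv.H_apply ε
      lie_e := hv.E_apply ε }
  exact P.exists_nat

theorem exists_idempotent {g : ℂ[X]} (hg : g ≠ 0) {c : ℂ} (hc : c ∈ g.roots) :
    ∃ ε r : ℂ[X], ε * ε = ε + r * g ∧ ∀ b ∈ g.roots, ε.eval b = if b = c then 1 else 0 := by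
  obtain ⟨g', hg', hdvd⟩ := Polynomial.exists_eq_pow_rootMultiplicity_mul_and_not_dvd g hg c
  set m := g.rootMultiplicity c with hm
  have hm0 : m ≠ 0 := by
    rw [mem_roots hg] at hc
    exact (Polynomial.rootMultiplicity_pos hg |>.2 hc).ne'
  have hcop : IsCoprime ((X - C c) ^ m) g' :=
    IsCoprime.pow_left ((Polynomial.irreducible_X_sub_C c).coprime_iff_not_dvd.2 hdvd)
  obtain ⟨a, b, hab⟩ := hcop
  -- Chinese remainder idempotent: `b * g'` is `1` modulo `(X - c) ^ m` and `0` modulo `g'`.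
  refine ⟨b * g', -(a * b), ?_, ?_⟩
  · have : b * g' = 1 - a * (X - C c) ^ m := by rw [← hab]; ring
    calc b * g' * (b * g') = b * g' * (1 - a * (X - C c) ^ m) := by rw [← this]
      _ = b * g' + -(a * b) * ((X - C c) ^ m * g') := by ring
      _ = _ := by rw [← hg']
  · intro d hd
    split_ifs with hdc
    · have := congrArg (eval d) hab
      simpa [hdc, hm0] using this
    · rw [mem_roots hg, IsRoot, hg', eval_mul, mul_eq_zero] at hd
      rcases hd with hd | hd
      · exfalso
        simp [hm0, sub_eq_zero] at hd
        exact hdc hd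
      · simp [hd]

/-- Up to a unit `g` is a product of linear factors, each dividing `p`; the number of roots serves
as exponent. -/
theorem exists_pow_of_eval_eq_zero {g : ℂ[X]} (hg : g ≠ 0) {p : ℂ[X]}
    (hp : ∀ b ∈ g.roots, p.eval b = 0) : ∃ m q, p ^ m = q * g := by
  have hsplit := IsAlgClosed.splits g
  by_cases hp0 : p = 0
  · exact ⟨1, 0, by simp [hp0]⟩
  suffices h : ∀ s : Multiset ℂ, (∀ b ∈ s, p.eval b = 0) →
      (s.map fun a => X - C a).prod ∣ p ^ s.card by
    have h1 := h g.roots hp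
    have h2 : g ∣ p ^ g.roots.card := by
      conv_lhs => rw [hsplit.eq_prod_roots]
      rwa [(isUnit_C.2 (isUnit_iff_ne_zero.2 (leadingCoeff_ne_zero.2 hg))).mul_left_dvd]
    obtain ⟨q, hq⟩ := h2
    exact ⟨_, q, by rw [hq, mul_comm]⟩
  intro s
  induction s using Multiset.induction_on with
  | empty => simp
  | cons a s ih =>
    intro hs
    rw [Multiset.map_cons, Multiset.prod_cons, Multiset.card_cons, pow_succ']
    exact mul_dvd_mul (dvd_iff_isRoot.2 (hs a (Multiset.mem_cons_self a s)))
      (ih fun b hb => hs b (Multiset.mem_cons_of_mem hb))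

/-- The highest weight of a finite-dimensional representation is a nonnegative integral combination
of evaluations. -/
theorem IsHighestWeight.exists_eq_sum_eval [FiniteDimensional ℂ V] (hv : ρ.IsHighestWeight v φ) :
    ∃ (S : Finset ℂ) (n : ℂ → ℕ), ∀ p, φ p = ∑ c ∈ S, n c * p.eval c := by
  obtain ⟨g, hg0, hg⟩ := ρ.exists_F_eq_zero
  have hε : ∀ c : ℂ, ∃ ε : ℂ[X], ∃ n : ℕ, c ∈ g.roots →
      (φ ε = n ∧ ∀ b ∈ g.roots, ε.eval b = if b = c then 1 else 0) := by
    intro c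
    by_cases hc : c ∈ g.roots
    · obtain ⟨ε, r, h1, h2⟩ := exists_idempotent hg0 hc
      obtain ⟨n, hn⟩ := hv.exists_nat hg h1
      exact ⟨ε, n, fun _ => ⟨hn, h2⟩⟩
    · exact ⟨0, 0, fun h => absurd h hc⟩
  choose ε n hεn using hε
  refine ⟨g.roots.toFinset, n, fun p => ?_⟩
  -- Subtracting the interpolation of `p` by the idempotents leaves a polynomial vanishing at all
  -- roots of `g`, hence nilpotent modulo `g` and killed by `φ`.
  obtain ⟨m, q, hq⟩ := exists_pow_of_eval_eq_zero hg0
    (p := p - ∑ c ∈ g.roots.toFinset, p.eval c • ε c) (by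
      intro b hb
      rw [eval_sub, eval_finsetSum, Finset.sum_eq_single b]
      · simp [(hεn b hb).2 b hb]
      · intro c hc hcb
        rw [eval_smul, (hεn c (Multiset.mem_toFinset.1 hc)).2 b hb, if_neg hcb.symm, smul_zero]
      · intro h
        exact absurd (Multiset.mem_toFinset.2 hb) h)
  have h0 := hv.eq_zero_of_pow hg hq
  rw [map_sub, map_sum, sub_eq_zero] at h0
  rw [h0]
  refine Finset.sum_congr rfl fun c hc => ?_
  rw [map_smul, (hεn c (Multiset.mem_toFinset.1 hc)).1, smul_eq_mul, mul_comm]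

end CurrentRep

end TwistedLoop

/-! ### The twisted loop algebra in terms of polynomials in `t + t⁻¹` -/

namespace TwistedLoop

open Polynomial

/-- The Chevalley generator `f` of `sl₂`. -/
def f : sl2 := LieAlgebra.SpecialLinear.single 1 0 (by decide) 1

theorem lie_e_f : ⁅e, f⁆ = h := by
  ext i j
  rw [LieAlgebra.SpecialLinear.sl_bracket]
  fin_cases i <;> fin_cases j <;> simp [e, f, h]

theorem lie_h_e : ⁅h, e⁆ = (2 : ℂ) • e := by
  ext i j
  rw [LieAlgebra.SpecialLinear.sl_bracket]
  fin_cases i <;> fin_cases j <;>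
    norm_num [e, f, h, Matrix.mul_apply]

theorem lie_h_f : ⁅h, f⁆ = (-2 : ℂ) • f := by
  ext i j
  rw [LieAlgebra.SpecialLinear.sl_bracket]
  fin_cases i <;> fin_cases j <;>
    norm_num [e, f, h, Matrix.mul_apply]

theorem sl2_apply_one_one (x : sl2) : x.val 1 1 = -x.val 0 0 := by
  have : Matrix.trace x.val = 0 := x.2
  rw [Matrix.trace_fin_two] at this
  linear_combination this

theorem sl2_eq (x : sl2) : x = x.val 0 1 • e + x.val 0 0 • h + x.val 1 0 • f := by
  ext i j
  fin_cases i <;> fin_cases j <;> simp [e, f, h]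
  linear_combination sl2_apply_one_one x

theorem invert_aeval_tPlus (p : ℂ[X]) :
    LaurentPolynomial.invert (aeval tPlus p) = aeval tPlus p := by
  have := invert_tPlus_pow 1
  rw [pow_one] at this
  rw [← AlgEquiv.coe_toAlgHom, ← AlgHom.comp_apply]
  congr 1
  apply Polynomial.algHom_ext
  simpa using this

/-- The element `p(t + t⁻¹) ⊗ x` of the twisted loop algebra. -/
def cur (x : sl2) : ℂ[X] →ₗ[ℂ] Ltw where
  toFun p := ⟨aeval tPlus p ⊗ₜ[ℂ] x, by
    change extend LieEquiv.refl _ = _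
    rw [extend_tmul, invert_aeval_tPlus]
    rfl⟩
  map_add' p q := by
    apply Subtype.ext
    simp [TensorProduct.add_tmul]
  map_smul' c p := by
    apply Subtype.ext
    simp [TensorProduct.smul_tmul']

theorem coe_cur (x : sl2) (p : ℂ[X]) : (cur x p : Loop sl2) = aeval tPlus p ⊗ₜ[ℂ] x := rfl

theorem cur_smul (c : ℂ) (x : sl2) (p : ℂ[X]) : cur (c • x) p = c • cur x p := by
  apply Subtype.ext
  simp [coe_cur]

theorem cur_zero (p : ℂ[X]) : cur 0 p = 0 := by
  apply Subtype.ext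
  simp [coe_cur]

theorem lie_cur (x y : sl2) (p q : ℂ[X]) : ⁅cur x p, cur y q⁆ = cur ⁅x, y⁆ (p * q) := by
  apply Subtype.ext
  rw [LieSubalgebra.coe_bracket, coe_cur, coe_cur, coe_cur,
    LieAlgebra.ExtendScalars.bracket_tmul, map_mul]

theorem lie_cur_e_f (p q : ℂ[X]) : ⁅cur e p, cur f q⁆ = cur h (p * q) := by
  rw [lie_cur, lie_e_f]

theorem lie_cur_h_e (p q : ℂ[X]) : ⁅cur h p, cur e q⁆ = (2 : ℂ) • cur e (p * q) := by
  rw [lie_cur, lie_h_e, cur_smul]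

theorem lie_cur_h_f (p q : ℂ[X]) : ⁅cur h p, cur f q⁆ = (-2 : ℂ) • cur f (p * q) := by
  rw [lie_cur, lie_h_f, cur_smul]

theorem lie_cur_h_h (p q : ℂ[X]) : ⁅cur h p, cur h q⁆ = 0 := by
  rw [lie_cur, lie_self, cur_zero]

/-- Chebyshev recursion: multiplying the sum for `n + 1` by `t + t⁻¹` gives the sums for `n + 2` and
`n`. -/
theorem exists_T_add_T_neg (n : ℕ) : ∃ p : ℂ[X],
    (LaurentPolynomial.T n + LaurentPolynomial.T (-n) : ℂ[T;T⁻¹]) = aeval tPlus p := by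
  induction n using Nat.twoStepInduction with
  | zero => exact ⟨2, by rw [map_ofNat]; simp [one_add_one_eq_two]⟩
  | one => exact ⟨X, by simp [tPlus]⟩
  | more n h1 h2 =>
    obtain ⟨p, hp⟩ := h1
    obtain ⟨q, hq⟩ := h2
    refine ⟨X * q - p, ?_⟩
    rw [map_sub, map_mul, ← hp, ← hq, aeval_X, tPlus]
    simp only [add_mul, mul_add, ← LaurentPolynomial.T_add]
    have e1 : (1 : ℤ) + -((n + 1 : ℕ) : ℤ) = -n := by push_cast; ring
    have e2 : (-1 : ℤ) + ((n + 1 : ℕ) : ℤ) = n := by push_cast; ring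
    have e3 : (1 : ℤ) + ((n + 1 : ℕ) : ℤ) = (n + 2 : ℕ) := by push_cast; ring
    have e4 : (-1 : ℤ) + -((n + 1 : ℕ) : ℤ) = -(n + 2 : ℕ) := by push_cast; ring
    rw [e1, e2, e3, e4]
    abel

theorem exists_add_invert (P : ℂ[T;T⁻¹]) : ∃ p : ℂ[X],
    P + LaurentPolynomial.invert P = aeval tPlus p := by
  induction P using LaurentPolynomial.induction_on' with
  | add P Q hP hQ =>
    obtain ⟨p, hp⟩ := hP
    obtain ⟨q, hq⟩ := hQ
    exact ⟨p + q, by rw [map_add, map_add, ← hp, ← hq]; abel⟩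
  | C_mul_T n a =>
    obtain ⟨p, hp⟩ : ∃ p : ℂ[X],
        (LaurentPolynomial.T n + LaurentPolynomial.T (-n) : ℂ[T;T⁻¹]) = aeval tPlus p := by
      obtain ⟨m, rfl | rfl⟩ := n.eq_nat_or_neg
      · exact exists_T_add_T_neg m
      · obtain ⟨p, hp⟩ := exists_T_add_T_neg m
        exact ⟨p, by rw [neg_neg, add_comm, hp]⟩
    refine ⟨a • p, ?_⟩
    rw [map_mul, LaurentPolynomial.invert_C, LaurentPolynomial.invert_T, ← mul_add, hp, map_smul,
      LaurentPolynomial.smul_eq_C_mul]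

theorem exists_half_add_invert (P : ℂ[T;T⁻¹]) : ∃ p : ℂ[X],
    (2⁻¹ : ℂ) • (P + LaurentPolynomial.invert P) = aeval tPlus p := by
  obtain ⟨p, hp⟩ := exists_add_invert P
  exact ⟨(2⁻¹ : ℂ) • p, by rw [hp, map_smul]⟩

/-- Averaging projects onto the fixed points. Descriptions of `Ltw` can thus be proved for averages
of arbitrary elements of the full loop algebra, where induction on tensors applies. -/
theorem Ltw_eq_half (z : Ltw) :
    (z : Loop sl2) = (2⁻¹ : ℂ) • ((z : Loop sl2) + extend LieEquiv.refl (z : Loop sl2)) := by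
  have hz : extend LieEquiv.refl (z : Loop sl2) = z := z.2
  rw [hz, ← two_smul ℂ (z : Loop sl2), smul_smul]
  norm_num

theorem half_tmul (P : ℂ[T;T⁻¹]) (x : sl2) :
    (2⁻¹ : ℂ) • (P ⊗ₜ[ℂ] x + extend LieEquiv.refl (P ⊗ₜ[ℂ] x)) =
      ((2⁻¹ : ℂ) • (P + LaurentPolynomial.invert P)) ⊗ₜ[ℂ] x := by
  rw [extend_tmul, ← TensorProduct.smul_tmul', TensorProduct.add_tmul]
  rfl

theorem exists_half_eq_cur (y : Loop sl2) : ∃ p q r : ℂ[X],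
    (2⁻¹ : ℂ) • (y + extend LieEquiv.refl y) = (cur e p + cur h q + cur f r : Ltw) := by
  induction y using TensorProduct.induction_on with
  | zero => exact ⟨0, 0, 0, by simp⟩
  | tmul P x =>
    obtain ⟨p, hp⟩ := exists_half_add_invert P
    refine ⟨x.val 0 1 • p, x.val 0 0 • p, x.val 1 0 • p, ?_⟩
    rw [half_tmul, hp]
    conv_lhs => rw [sl2_eq x]
    simp [coe_cur, TensorProduct.tmul_add]
  | add y z hy hz =>
    obtain ⟨p, q, r, h1⟩ := hy
    obtain ⟨p', q', r', h2⟩ := hz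
    refine ⟨p + p', q + q', r + r', ?_⟩
    have : (2⁻¹ : ℂ) • (y + z + extend LieEquiv.refl (y + z)) =
        (2⁻¹ : ℂ) • (y + extend LieEquiv.refl y) + (2⁻¹ : ℂ) • (z + extend LieEquiv.refl z) := by
      rw [map_add, ← smul_add]; congr 1; abel
    rw [this, h1, h2, map_add, map_add, map_add]
    push_cast
    abel

theorem exists_eq_cur (z : Ltw) : ∃ p q r : ℂ[X], z = cur e p + cur h q + cur f r := by
  obtain ⟨p, q, r, h1⟩ := exists_half_eq_cur z
  exact ⟨p, q, r, Subtype.ext (by rw [← h1]; exact Ltw_eq_half z)⟩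

theorem exists_eq_cur_of_mem_twistedPart {x : sl2} {z : Ltw}
    (hz : z ∈ twistedPart LieEquiv.refl (Submodule.span ℂ {x})) : ∃ p : ℂ[X], z = cur x p := by
  obtain ⟨y, hy⟩ := hz
  have key : ∀ y : ℂ[T;T⁻¹] ⊗[ℂ] (Submodule.span ℂ {x}), ∃ P : ℂ[T;T⁻¹],
      LinearMap.lTensor ℂ[T;T⁻¹] (Submodule.span ℂ {x}).subtype y = P ⊗ₜ[ℂ] x := by
    intro y
    induction y using TensorProduct.induction_on with
    | zero => exact ⟨0, by simp⟩
    | tmul P u =>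
      obtain ⟨c, hc⟩ := Submodule.mem_span_singleton.1 u.2
      refine ⟨c • P, ?_⟩
      rw [LinearMap.lTensor_tmul, Submodule.subtype_apply, ← hc, TensorProduct.smul_tmul]
    | add y z hy hz =>
      obtain ⟨P, hP⟩ := hy
      obtain ⟨Q, hQ⟩ := hz
      exact ⟨P + Q, by rw [map_add, hP, hQ, TensorProduct.add_tmul]⟩
  obtain ⟨P, hP⟩ := key y
  rw [hP] at hy
  obtain ⟨p, hp⟩ := exists_half_add_invert P
  refine ⟨p, Subtype.ext ?_⟩
  rw [Ltw_eq_half z, coe_cur, ← hp, ← half_tmul, hy]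
  rfl

theorem cur_mem_twistedPart (x : sl2) (p : ℂ[X]) :
    cur x p ∈ twistedPart LieEquiv.refl (Submodule.span ℂ {x}) :=
  ⟨aeval tPlus p ⊗ₜ[ℂ] ⟨x, Submodule.mem_span_singleton_self x⟩, rfl⟩

theorem cur_e_mem (p : ℂ[X]) : cur e p ∈ LtwPos := cur_mem_twistedPart e p

/-- The element `p(t + t⁻¹) ⊗ h` of the zero part. -/
def curZero : ℂ[X] →ₗ[ℂ] LtwZero := (cur h).codRestrict LtwZero (cur_mem_twistedPart h)

theorem coe_curZero (p : ℂ[X]) : (curZero p : Ltw) = cur h p := rfl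

theorem curZero_X_pow (a : ℕ) : curZero (X ^ a) = w a := by
  apply Subtype.ext
  apply Subtype.ext
  rw [coe_curZero, coe_cur, map_pow, aeval_X]
  rfl

theorem exists_eq_curZero (z : LtwZero) : ∃ p, z = curZero p := by
  obtain ⟨p, hp⟩ := exists_eq_cur_of_mem_twistedPart z.2
  exact ⟨p, Subtype.ext hp⟩

end TwistedLoop

namespace TwistedLoop

/-! ### Verma modules of `R ⊗ sl₂`, realized by differential operators -/

namespace Verma

open MvPolynomial

variable {R κ : Type*} [CommRing R] [Algebra ℂ R] (b : Module.Basis κ ℂ R) (ψ : R →ₗ[ℂ] ℂ)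

/-- Linearity of `E` and the relations among `E` and `H` reduce through this to commutators with
multiplication by a variable. -/
theorem end_ext {A B : Module.End ℂ (MvPolynomial κ ℂ)} (h1 : A 1 = B 1)
    (hX : ∀ i m, A m = B m → A (X i * m) = B (X i * m)) : A = B := by
  refine LinearMap.ext fun m => ?_
  induction m using MvPolynomial.induction_on with
  | C a => rw [← mul_one (C a), ← smul_eq_C_mul, map_smul, map_smul, h1]
  | add p q hp hq => rw [map_add, map_add, hp, hq]
  | mul_X p i hp => rw [mul_comm]; exact hX i p hp

/-- The linear form on the variables corresponding to an element of `R`. -/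
def var : R →ₗ[ℂ] MvPolynomial κ ℂ := b.constr ℂ X

@[simp] theorem var_basis (i : κ) : var b (b i) = X i := b.constr_basis ℂ X i

/-- The derivation `∑ᵢ (a bᵢ) ∂ᵢ`. -/
def shift (a : R) : Derivation ℂ (MvPolynomial κ ℂ) (MvPolynomial κ ℂ) :=
  mkDerivation ℂ fun i => var b (a * b i)

@[simp] theorem shift_X (a : R) (i : κ) : shift b a (X i) = var b (a * b i) :=
  mkDerivation_X _ _ _

/-- The action of `R ⊗ f`. -/
def F : R →ₗ[ℂ] Module.End ℂ (MvPolynomial κ ℂ) := LinearMap.mul ℂ _ ∘ₗ var b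

theorem F_apply (a : R) (m : MvPolynomial κ ℂ) : F b a m = var b a * m := rfl

/-- The action of `R ⊗ h`. -/
def H : R →ₗ[ℂ] Module.End ℂ (MvPolynomial κ ℂ) where
  toFun a := ψ a • 1 - (2 : ℂ) • (shift b a : MvPolynomial κ ℂ →ₗ[ℂ] MvPolynomial κ ℂ)
  map_add' a c := by
    have : shift b (a + c) = shift b a + shift b c :=
      derivation_ext fun i => by simp [add_mul]
    rw [this, map_add, Derivation.coe_add_linearMap]
    module
  map_smul' r a := by
    have : shift b (r • a) = r • shift b a :=
      derivation_ext fun i => by simp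
    rw [this, map_smul, Derivation.coe_smul_linearMap, RingHom.id_apply, smul_eq_mul]
    module

theorem H_apply (a : R) (m : MvPolynomial κ ℂ) :
    H b ψ a m = ψ a • m - (2 : ℂ) • shift b a m := rfl

theorem H_one (a : R) : H b ψ a 1 = ψ a • 1 := by
  rw [H_apply, Derivation.map_one_eq_zero, smul_zero, sub_zero]

theorem H_X_mul (a : R) (i : κ) (m : MvPolynomial κ ℂ) :
    H b ψ a (X i * m) = X i * H b ψ a m + (-2 : ℂ) • F b (a * b i) m := by
  rw [H_apply, H_apply, F_apply, Derivation.leibniz, shift_X, smul_eq_mul, smul_eq_mul, mul_sub,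
    mul_smul_comm, mul_smul_comm, mul_comm m]
  module

/-- The second order operator `∑ᵢⱼ (a bᵢ bⱼ) ∂ᵢ ∂ⱼ`. -/
def laplace (a : R) : Module.End ℂ (MvPolynomial κ ℂ) :=
  (basisMonomials κ ℂ).constr ℂ fun s =>
    ∑ j ∈ s.support, shift b (a * b j) (pderiv j (monomial s 1))

/-- The freedom in `t` allows `m` and `X i * m` to be expanded over a common index set. -/
theorem laplace_monomial (a : R) (s : κ →₀ ℕ) {t : Finset κ} (hst : s.support ⊆ t) :
    laplace b a (monomial s 1) = ∑ j ∈ t, shift b (a * b j) (pderiv j (monomial s 1)) := by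
  have h1 := (basisMonomials κ ℂ).constr_basis ℂ (fun s =>
    ∑ j ∈ s.support, shift b (a * b j) (pderiv j (monomial s (1 : ℂ)))) s
  rw [coe_basisMonomials] at h1
  rw [laplace, h1]
  refine Finset.sum_subset hst fun j _ hj => ?_
  rw [pderiv_monomial, Finsupp.notMem_support_iff.1 hj]
  simp

theorem shift_monomial (a : R) (s : κ →₀ ℕ) {t : Finset κ} (hst : s.support ⊆ t) :
    shift b a (monomial s 1) = ∑ j ∈ t, pderiv j (monomial s (1 : ℂ)) * var b (a * b j) := by
  rw [shift, mkDerivation_monomial, one_smul, Finsupp.sum]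
  refine (Finset.sum_subset hst fun j _ hj => ?_).trans ?_
  · rw [Finsupp.notMem_support_iff.1 hj]
    simp
  · refine Finset.sum_congr rfl fun j _ => ?_
    rw [pderiv_monomial, one_mul, smul_eq_mul]

/-- Either of the two derivatives may hit `X i`, and both cases contribute the same first-order
operator; hence the factor `2`. -/
theorem laplace_X_mul (a : R) (i : κ) (m : MvPolynomial κ ℂ) :
    laplace b a (X i * m) = X i * laplace b a m + (2 : ℂ) • shift b (a * b i) m := by
  classical
  induction m using MvPolynomial.induction_on' with
  | add p q hp hq =>
    simp only [mul_add, map_add, hp, hq]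
    module
  | monomial s r =>
    suffices h : laplace b a (X i * monomial s 1) =
        X i * laplace b a (monomial s 1) + (2 : ℂ) • shift b (a * b i) (monomial s 1) by
      have hr : (monomial s r : MvPolynomial κ ℂ) = r • monomial s 1 := by
        rw [smul_monomial, smul_eq_mul, mul_one]
      rw [hr, mul_smul_comm, map_smul, h, map_smul, Derivation.map_smul, mul_smul_comm]
      module
    have hX : (X i * monomial s 1 : MvPolynomial κ ℂ) = monomial (Finsupp.single i 1 + s) 1 := by
      rw [X, monomial_mul, one_mul]
    have hs : s.support ⊆ insert i s.support := Finset.subset_insert _ _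
    have hs' : (Finsupp.single i 1 + s).support ⊆ insert i s.support :=
      Finsupp.support_add.trans (Finset.union_subset
        (Finsupp.support_single_subset.trans (by simp)) hs)
    rw [hX, laplace_monomial b a _ hs', ← hX, laplace_monomial b a s hs]
    have hterm : ∀ j, shift b (a * b j) (pderiv j (X i * monomial s 1)) =
        X i * shift b (a * b j) (pderiv j (monomial s 1)) +
        (pderiv j (monomial s 1) * var b (a * b i * b j) +
          if j = i then shift b (a * b i) (monomial s 1) else 0) := by
      intro j
      rw [pderiv_mul, map_add, Derivation.leibniz _ (X i), shift_X, pderiv_X, smul_eq_mul,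
        smul_eq_mul, mul_right_comm a]
      by_cases hj : j = i
      · subst hj
        rw [Pi.single_eq_same, one_mul, if_pos rfl]
        ring
      · rw [Pi.single_eq_of_ne (Ne.symm hj), zero_mul, map_zero, if_neg hj]
        ring
    rw [Finset.sum_congr rfl fun j _ => hterm j, Finset.sum_add_distrib, Finset.sum_add_distrib,
      ← Finset.mul_sum, ← shift_monomial b (a * b i) s hs, Finset.sum_ite_eq',
      if_pos (Finset.mem_insert_self _ _), two_smul]

theorem laplace_one (a : R) : laplace b a 1 = 0 := by
  have := laplace_monomial b a 0 (t := ∅) (by simp)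
  simpa using this

/-- The action of a single element of `R ⊗ e`. -/
def eOp (a : R) : Module.End ℂ (MvPolynomial κ ℂ) :=
  (mkDerivation ℂ fun i => C (ψ (a * b i)) :
    Derivation ℂ (MvPolynomial κ ℂ) (MvPolynomial κ ℂ)) - laplace b a

theorem eOp_one (a : R) : eOp b ψ a 1 = 0 := by
  rw [eOp, LinearMap.sub_apply, laplace_one, Derivation.coeFn_coe, Derivation.map_one_eq_zero,
    sub_zero]

/-- This is `[e, f] = h` on a basis: the first-order part of `eOp` supplies `ψ (a * b i)`, the
second-order part supplies `-2 • shift`. -/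
theorem eOp_X_mul (a : R) (i : κ) (m : MvPolynomial κ ℂ) :
    eOp b ψ a (X i * m) = X i * eOp b ψ a m + H b ψ (a * b i) m := by
  rw [eOp, LinearMap.sub_apply, LinearMap.sub_apply, laplace_X_mul, Derivation.coeFn_coe,
    Derivation.leibniz, mkDerivation_X, H_apply, smul_eq_mul, smul_eq_mul, mul_comm m,
    ← smul_eq_C_mul]
  ring

/-- The action of `R ⊗ e`. -/
def E : R →ₗ[ℂ] Module.End ℂ (MvPolynomial κ ℂ) where
  toFun := eOp b ψ
  map_add' a c := by
    refine end_ext (by simp [eOp_one]) fun i m hm => ?_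
    rw [LinearMap.add_apply] at hm ⊢
    rw [eOp_X_mul, eOp_X_mul, eOp_X_mul, hm, add_mul, map_add, LinearMap.add_apply]
    ring
  map_smul' r a := by
    refine end_ext (by simp [eOp_one]) fun i m hm => ?_
    rw [RingHom.id_apply, LinearMap.smul_apply] at hm ⊢
    rw [eOp_X_mul, eOp_X_mul, hm, smul_mul_assoc, map_smul, LinearMap.smul_apply, smul_add,
      mul_smul_comm]

theorem E_one (a : R) : E b ψ a 1 = 0 := eOp_one b ψ a

theorem E_X_mul (a : R) (i : κ) (m : MvPolynomial κ ℂ) :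
    E b ψ a (X i * m) = X i * E b ψ a m + H b ψ (a * b i) m := eOp_X_mul b ψ a i m

theorem E_mul_F (a c : R) : E b ψ a * F b c = F b c * E b ψ a + H b ψ (a * c) := by
  have : LinearMap.mulLeft ℂ (E b ψ a) ∘ₗ F b =
      LinearMap.mulRight ℂ (E b ψ a) ∘ₗ F b + H b ψ ∘ₗ LinearMap.mulLeft ℂ a := by
    refine b.ext fun i => LinearMap.ext fun m => ?_
    have := E_X_mul b ψ a i m
    simpa [F_apply] using this
  exact LinearMap.congr_fun this c

theorem H_mul_F (a c : R) : H b ψ a * F b c = F b c * H b ψ a + (-2 : ℂ) • F b (a * c) := by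
  have : LinearMap.mulLeft ℂ (H b ψ a) ∘ₗ F b =
      LinearMap.mulRight ℂ (H b ψ a) ∘ₗ F b + (-2 : ℂ) • (F b ∘ₗ LinearMap.mulLeft ℂ a) := by
    refine b.ext fun i => LinearMap.ext fun m => ?_
    have := H_X_mul b ψ a i m
    simpa [F_apply] using this
  exact LinearMap.congr_fun this c

theorem F_mul_F (a c : R) : F b a * F b c = F b c * F b a := by
  refine LinearMap.ext fun m => ?_
  simp only [Module.End.mul_apply, F_apply]
  ring

theorem H_mul_H (a c : R) : H b ψ a * H b ψ c = H b ψ c * H b ψ a := by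
  have hHF : ∀ a c m, H b ψ a (F b c m) = F b c (H b ψ a m) + (-2 : ℂ) • F b (a * c) m :=
    fun a c m => LinearMap.congr_fun (H_mul_F b ψ a c) m
  refine end_ext ?_ fun i m hm => ?_
  · simp only [Module.End.mul_apply, H_one, map_smul]
    module
  · simp only [Module.End.mul_apply] at hm ⊢
    rw [H_X_mul, map_add, H_X_mul, map_smul, hHF, hm, H_X_mul, map_add, H_X_mul, map_smul, hHF,
      mul_left_comm a]
    module

theorem H_mul_E (a c : R) : H b ψ a * E b ψ c = E b ψ c * H b ψ a + (2 : ℂ) • E b ψ (a * c) := by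
  have hEF : ∀ a c m, E b ψ a (F b c m) = F b c (E b ψ a m) + H b ψ (a * c) m :=
    fun a c m => LinearMap.congr_fun (E_mul_F b ψ a c) m
  refine end_ext ?_ fun i m hm => ?_
  · simp [H_one, E_one]
  · simp only [Module.End.mul_apply, LinearMap.add_apply, LinearMap.smul_apply] at hm ⊢
    have hHH : H b ψ a (H b ψ (c * b i) m) = H b ψ (c * b i) (H b ψ a m) :=
      LinearMap.congr_fun (H_mul_H b ψ a (c * b i)) m
    rw [E_X_mul, map_add, H_X_mul, hm, hHH, H_X_mul, map_add, map_smul, E_X_mul, E_X_mul, hEF,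
      mul_left_comm c, mul_assoc a, mul_add, mul_smul_comm]
    module

theorem E_mul_E (a c : R) : E b ψ a * E b ψ c = E b ψ c * E b ψ a := by
  have hHE : ∀ a c m, H b ψ a (E b ψ c m) = E b ψ c (H b ψ a m) + (2 : ℂ) • E b ψ (a * c) m :=
    fun a c m => LinearMap.congr_fun (H_mul_E b ψ a c) m
  refine end_ext (by simp [E_one]) fun i m hm => ?_
  simp only [Module.End.mul_apply] at hm ⊢
  rw [E_X_mul, map_add, E_X_mul, hm, hHE, E_X_mul, map_add, E_X_mul, hHE, mul_right_comm c,
    mul_comm c a, mul_right_comm a]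
  abel

/-- `shift b 1` is the Euler derivation, so `H 1` acts in degree `d` by `ψ 1 - 2 * d`. -/
theorem constantCoeff_H_one (m : MvPolynomial κ ℂ) :
    constantCoeff (H b ψ 1 m) = ψ 1 * constantCoeff m := by
  induction m using MvPolynomial.induction_on with
  | C r =>
    rw [← mul_one (C r), ← smul_eq_C_mul, map_smul, H_one]
    simp [smul_eq_C_mul, mul_comm]
  | add p q hp hq => rw [map_add, map_add, hp, hq, map_add, mul_add]
  | mul_X p i _ =>
    rw [mul_comm p, H_X_mul, F_apply, one_mul, var_basis]
    simp [smul_eq_C_mul]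

attribute [local instance] LieRing.ofAssociativeRing

/-- The action of `R ⊗ sl₂` on the Verma module, as a linear map. -/
def actionₗ : R ⊗[ℂ] sl2 →ₗ[ℂ] Module.End ℂ (MvPolynomial κ ℂ) :=
  TensorProduct.lift <| LinearMap.mk₂ ℂ
    (fun a x => x.val 0 1 • E b ψ a + x.val 0 0 • H b ψ a + x.val 1 0 • F b a)
    (fun a c x => by simp only [map_add]; module)
    (fun r a x => by simp only [map_smul]; module)
    (fun a x y => by
      have hxy : ∀ i j, (x + y).val i j = x.val i j + y.val i j := fun i j => rfl
      simp only [hxy]; module)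
    (fun r a x => by
      have hrx : ∀ i j, (r • x).val i j = r * x.val i j := fun i j => rfl
      simp only [hrx]; module)

theorem actionₗ_tmul (a : R) (x : sl2) : actionₗ b ψ (a ⊗ₜ x) =
    x.val 0 1 • E b ψ a + x.val 0 0 • H b ψ a + x.val 1 0 • F b a := rfl

theorem actionₗ_lie_tmul (a c : R) (x y : sl2) : actionₗ b ψ ((a * c) ⊗ₜ[ℂ] ⁅x, y⁆) =
    actionₗ b ψ (a ⊗ₜ x) * actionₗ b ψ (c ⊗ₜ y) - actionₗ b ψ (c ⊗ₜ y) * actionₗ b ψ (a ⊗ₜ x) := by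
  simp only [actionₗ_tmul, LieAlgebra.SpecialLinear.sl_bracket, Matrix.sub_apply, Matrix.mul_apply,
    Fin.sum_univ_two, sl2_apply_one_one, mul_add, add_mul, smul_mul_assoc, mul_smul_comm,
    H_mul_F, H_mul_E,
    E_mul_F, H_mul_H b ψ c a, E_mul_E b ψ c a, F_mul_F b c a, mul_comm c a]
  module

/-- The action of `R ⊗ sl₂` on the Verma module. -/
def action : R ⊗[ℂ] sl2 →ₗ⁅ℂ⁆ Module.End ℂ (MvPolynomial κ ℂ) where
  __ := actionₗ b ψ
  map_lie' {x y} := by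
    change actionₗ b ψ ⁅x, y⁆ = ⁅actionₗ b ψ x, actionₗ b ψ y⁆
    rw [LieRing.of_associative_ring_bracket]
    induction x using TensorProduct.induction_on with
    | zero => simp
    | add x z hx hz => rw [add_lie, map_add, map_add, hx, hz, add_mul, mul_add]; abel
    | tmul a x =>
      induction y using TensorProduct.induction_on with
      | zero => rw [lie_zero (a ⊗ₜ[ℂ] x)]; simp
      | add y z hy hz => rw [lie_add (a ⊗ₜ[ℂ] x), map_add, map_add, hy, hz, add_mul, mul_add]; abel
      | tmul c y => rw [LieAlgebra.ExtendScalars.bracket_tmul, actionₗ_lie_tmul]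

theorem action_tmul_e (a : R) : action b ψ (a ⊗ₜ e) = E b ψ a := by
  change actionₗ b ψ _ = _
  simp [actionₗ_tmul, e]

theorem action_tmul_h (a : R) : action b ψ (a ⊗ₜ h) = H b ψ a := by
  change actionₗ b ψ _ = _
  simp [actionₗ_tmul, h]

end Verma

end TwistedLoop

/-! ### Universal and simple highest weight modules of a general Lie algebra -/

namespace TwistedLoop

section HighestWeight

attribute [local instance] LieRing.ofAssociativeRing

variable {A : Type*} [LieRing A] [LieAlgebra ℂ A]

local notation "U" => UniversalEnvelopingAlgebra ℂ

/-- The map `ι` corestricts to the subalgebra `S`; its lift followed by the inclusion of `S` is the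
identity by uniqueness of lifts. -/
theorem adjoin_range_ι :
    Algebra.adjoin ℂ (Set.range (UniversalEnvelopingAlgebra.ι ℂ (L := A))) = ⊤ := by
  set S := Algebra.adjoin ℂ (Set.range (UniversalEnvelopingAlgebra.ι ℂ (L := A)))
  have hmem : ∀ x : A, UniversalEnvelopingAlgebra.ι ℂ x ∈ S := fun x =>
    Algebra.subset_adjoin ⟨x, rfl⟩
  let g : A →ₗ⁅ℂ⁆ S :=
    { toFun := fun x => ⟨UniversalEnvelopingAlgebra.ι ℂ x, hmem x⟩
      map_add' := fun x y => Subtype.ext (map_add _ x y)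
      map_smul' := fun c x => Subtype.ext (map_smul _ c x)
      map_lie' := fun {x y} => Subtype.ext (LieHom.map_lie _ x y) }
  have hid : S.val.comp (UniversalEnvelopingAlgebra.lift ℂ g) = AlgHom.id ℂ (U A) := by
    apply UniversalEnvelopingAlgebra.hom_ext
    ext x
    change S.val (UniversalEnvelopingAlgebra.lift ℂ g (UniversalEnvelopingAlgebra.ι ℂ x)) = _
    rw [UniversalEnvelopingAlgebra.lift_ι_apply]
    rfl
  rw [eq_top_iff]
  intro u _
  have := AlgHom.congr_fun hid u
  rw [AlgHom.id_apply] at this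
  rw [← this]
  exact (UniversalEnvelopingAlgebra.lift ℂ g u).2

theorem smul_mem_of_ι_smul_mem {M : Type*} [AddCommGroup M] [Module ℂ M] [Module (U A) M]
    [IsScalarTower ℂ (U A) M] (W : Submodule ℂ M)
    (hW : ∀ x : A, ∀ m ∈ W, UniversalEnvelopingAlgebra.ι ℂ x • m ∈ W) (u : U A) {m : M}
    (hm : m ∈ W) : u • m ∈ W := by
  have hu : u ∈ Algebra.adjoin ℂ (Set.range (UniversalEnvelopingAlgebra.ι ℂ (L := A))) := by
    rw [adjoin_range_ι]; trivial
  induction hu using Algebra.adjoin_induction generalizing m with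
  | mem u hu =>
    obtain ⟨x, rfl⟩ := hu
    exact hW x m hm
  | algebraMap c => rw [algebraMap_smul]; exact W.smul_mem c hm
  | add u u' _ _ h h' => rw [add_smul]; exact add_mem (h hm) (h' hm)
  | mul u u' _ _ h h' => rw [mul_smul]; exact h (h' hm)

theorem ι_smul_ι_smul {M : Type*} [AddCommGroup M] [Module (U A) M] (x y : A) (m : M) :
    UniversalEnvelopingAlgebra.ι ℂ x • UniversalEnvelopingAlgebra.ι ℂ y • m =
      UniversalEnvelopingAlgebra.ι ℂ y • UniversalEnvelopingAlgebra.ι ℂ x • m +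
        UniversalEnvelopingAlgebra.ι ℂ ⁅x, y⁆ • m := by
  rw [LieHom.map_lie, LieRing.of_associative_ring_bracket, sub_smul, mul_smul, mul_smul]
  abel

open Polynomial in
theorem aeval_smul_of_eigenvector {M : Type*} [AddCommGroup M] [Module ℂ M] [Module (U A) M]
    [IsScalarTower ℂ (U A) M] {x : U A} {c : ℂ} {m : M} (hm : x • m = c • m) (q : ℂ[X]) :
    aeval x q • m = q.eval c • m := by
  induction q using Polynomial.induction_on' with
  | add p q hp hq => rw [map_add, add_smul, hp, hq, eval_add, add_smul]
  | monomial n a =>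
    have hn : x ^ n • m = c ^ n • m := by
      induction n with
      | zero => simp
      | succ n ih =>
        rw [pow_succ, mul_smul, hm, ← algebraMap_smul (U A) c m, ← mul_smul, ← Algebra.commutes,
          mul_smul, ih, algebraMap_smul, smul_smul, pow_succ']
    rw [aeval_monomial, mul_smul, hn, algebraMap_smul, eval_monomial, smul_smul]

open Polynomial in
theorem apply_aeval_smul {M : Type*} [AddCommGroup M] [Module ℂ M] [Module (U A) M]
    [IsScalarTower ℂ (U A) M] (χ : M →ₗ[ℂ] ℂ) {x : U A} {c : ℂ}
    (hχ : ∀ m, χ (x • m) = c * χ m) (q : ℂ[X]) (m : M) :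
    χ (aeval x q • m) = q.eval c * χ m := by
  induction q using Polynomial.induction_on' with
  | add p q hp hq => rw [map_add, add_smul, map_add, hp, hq, eval_add, add_mul]
  | monomial n a =>
    have hn : χ (x ^ n • m) = c ^ n * χ m := by
      induction n with
      | zero => simp
      | succ n ih => rw [pow_succ', mul_smul, hχ, ih, pow_succ', mul_assoc]
    rw [aeval_monomial, mul_smul, algebraMap_smul, map_smul, hn, eval_monomial, smul_eq_mul,
      mul_assoc]

variable (P Z : Submodule ℂ A) (φ : Module.Dual ℂ Z)

/-- The canonical generator of the universal highest weight module. -/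
def vacuum : Universal P Z φ := (highestWeightIdeal P Z φ).mkQ 1

variable {P Z φ}

theorem mkQ_eq_smul_vacuum (u : U A) :
    (highestWeightIdeal P Z φ).mkQ u = u • vacuum P Z φ := by
  rw [vacuum, ← map_smul, smul_eq_mul, mul_one]

theorem exists_eq_smul_vacuum (m : Universal P Z φ) : ∃ u : U A, m = u • vacuum P Z φ := by
  obtain ⟨u, rfl⟩ := Submodule.mkQ_surjective _ m
  exact ⟨u, mkQ_eq_smul_vacuum u⟩

theorem eq_top_of_vacuum_mem {N : Submodule (U A) (Universal P Z φ)} (h : vacuum P Z φ ∈ N) :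
    N = ⊤ := by
  rw [eq_top_iff]
  intro m _
  obtain ⟨u, rfl⟩ := exists_eq_smul_vacuum m
  exact N.smul_mem u h

theorem ι_smul_vacuum_of_mem {x : A} (hx : x ∈ P) :
    UniversalEnvelopingAlgebra.ι ℂ x • vacuum P Z φ = 0 := by
  rw [← mkQ_eq_smul_vacuum, Submodule.mkQ_apply, Submodule.Quotient.mk_eq_zero]
  exact Submodule.subset_span (Or.inl ⟨x, hx, rfl⟩)

theorem ι_smul_vacuum (z : Z) :
    UniversalEnvelopingAlgebra.ι ℂ (z : A) • vacuum P Z φ = φ z • vacuum P Z φ := by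
  rw [← algebraMap_smul (U A) (φ z), ← sub_eq_zero, ← sub_smul, ← mkQ_eq_smul_vacuum,
    Submodule.mkQ_apply, Submodule.Quotient.mk_eq_zero]
  exact Submodule.subset_span (Or.inr ⟨z, rfl⟩)

/-- The largest `U A`-submodule contained in the kernel of a linear functional. -/
def largestInKer {M : Type*} [AddCommGroup M] [Module ℂ M] [Module (U A) M] (χ : M →ₗ[ℂ] ℂ) :
    Submodule (U A) M where
  carrier := {m | ∀ u : U A, χ (u • m) = 0}
  add_mem' {m m'} hm hm' u := by rw [smul_add, map_add, hm u, hm' u, add_zero]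
  zero_mem' u := by rw [smul_zero, map_zero]
  smul_mem' u m hm u' := by rw [← mul_smul]; exact hm _

/-- The universal property of the universal highest weight module. -/
theorem exists_universal_map {W : Type*} [AddCommGroup W] [Module ℂ W]
    (ρ : A →ₗ⁅ℂ⁆ Module.End ℂ W) {w₀ : W} (hP : ∀ x ∈ P, ρ x w₀ = 0)
    (hZ : ∀ z : Z, ρ z w₀ = φ z • w₀) :
    ∃ π : Universal P Z φ →ₗ[ℂ] W, π (vacuum P Z φ) = w₀ ∧
      ∀ u m, π (u • m) = UniversalEnvelopingAlgebra.lift ℂ ρ u (π m) := by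
  let _ : Module (U A) W := Module.compHom W (UniversalEnvelopingAlgebra.lift ℂ ρ).toRingHom
  have hsmul : ∀ (u : U A) (y : W), u • y = UniversalEnvelopingAlgebra.lift ℂ ρ u y :=
    fun _ _ => rfl
  have hle : highestWeightIdeal P Z φ ≤ LinearMap.ker (LinearMap.toSpanSingleton (U A) W w₀) := by
    rw [highestWeightIdeal, Submodule.span_le]
    rintro u (⟨x, hx, rfl⟩ | ⟨z, rfl⟩)
    · rw [SetLike.mem_coe, LinearMap.mem_ker, LinearMap.toSpanSingleton_apply, hsmul,
        UniversalEnvelopingAlgebra.lift_ι_apply, hP x hx]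
    · rw [SetLike.mem_coe, LinearMap.mem_ker, LinearMap.toSpanSingleton_apply, hsmul, map_sub,
        UniversalEnvelopingAlgebra.lift_ι_apply, AlgHom.commutes, LinearMap.sub_apply, hZ,
        Module.algebraMap_end_apply, sub_self]
  let π := (highestWeightIdeal P Z φ).liftQ _ hle
  refine ⟨{ toFun := π
            map_add' := map_add π
            map_smul' := fun c m => ?_ }, ?_, fun u m => ?_⟩
  · rw [← algebraMap_smul (U A) c m, map_smul, hsmul, AlgHom.commutes,
      Module.algebraMap_end_apply, RingHom.id_apply]
  · change LinearMap.toSpanSingleton (U A) W w₀ 1 = w₀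
    simp
  · exact map_smul π u m

/-- A highest weight module that is finite-dimensional forces the simple one to be so. -/
theorem finiteDimensional_simple {W : Type*} [AddCommGroup W] [Module ℂ W]
    [FiniteDimensional ℂ W] (ρ : A →ₗ⁅ℂ⁆ Module.End ℂ W) {w₀ : W} (hw₀ : w₀ ≠ 0)
    (hP : ∀ x ∈ P, ρ x w₀ = 0) (hZ : ∀ z : Z, ρ z w₀ = φ z • w₀) :
    FiniteDimensional ℂ (Simple P Z φ) := by
  obtain ⟨π, hπ, hπu⟩ := exists_universal_map (φ := φ) ρ hP hZ
  let K : Submodule (U A) (Universal P Z φ) :=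
    { LinearMap.ker π with
      smul_mem' := fun u m hm => by
        have hm : π m = 0 := hm
        change π (u • m) = 0
        rw [hπu, hm, map_zero] }
  -- The kernel of `π` misses the generator because `w₀ ≠ 0`, so it is one of the proper submodules
  -- being summed.
  have hK : K ≤ maximalSubmodule P Z φ := by
    refine le_sSup fun htop => hw₀ ?_
    have : vacuum P Z φ ∈ K := htop ▸ Submodule.mem_top
    rw [← hπ]
    exact this
  let q : Universal P Z φ →ₗ[ℂ] Simple P Z φ := (maximalSubmodule P Z φ).mkQ.restrictScalars ℂ
  have hq : LinearMap.ker π ≤ LinearMap.ker q := fun m hm =>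
    (Submodule.Quotient.mk_eq_zero _).2 (hK hm)
  have : FiniteDimensional ℂ (Universal P Z φ ⧸ LinearMap.ker π) :=
    Module.Finite.equiv π.quotKerEquivRange.symm
  refine Module.Finite.of_surjective ((LinearMap.ker π).liftQ q hq) fun y => ?_
  obtain ⟨m, rfl⟩ := Submodule.mkQ_surjective _ y
  exact ⟨(LinearMap.ker π).mkQ m, rfl⟩

end HighestWeight

/-! ### Weight decomposition of `M(φ)` and properness of its maximal submodule -/

section Nonzero

open Polynomial

attribute [local instance] LieRing.ofAssociativeRing

local notation "U" => UniversalEnvelopingAlgebra ℂ Ltw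
local notation "ι" => UniversalEnvelopingAlgebra.ι ℂ (L := Ltw)

/-- The symmetrization `P ↦ (P(t) + P(t⁻¹)) / 2 ⊗ h`. -/
def symZero : ℂ[T;T⁻¹] →ₗ[ℂ] LtwZero where
  toFun P := ⟨⟨((2⁻¹ : ℂ) • (P + LaurentPolynomial.invert P)) ⊗ₜ[ℂ] h, by
      obtain ⟨p, hp⟩ := exists_half_add_invert P
      rw [hp]
      exact (cur h p).2⟩, by
      obtain ⟨p, hp⟩ := exists_half_add_invert P
      simp only [hp]
      exact cur_mem_twistedPart h p⟩
  map_add' P Q := by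
    apply Subtype.ext
    apply Subtype.ext
    change _ ⊗ₜ[ℂ] h = _ ⊗ₜ[ℂ] h + _ ⊗ₜ[ℂ] h
    rw [← TensorProduct.add_tmul, map_add]
    congr 1
    module
  map_smul' c P := by
    apply Subtype.ext
    apply Subtype.ext
    change _ ⊗ₜ[ℂ] h = c • _ ⊗ₜ[ℂ] h
    rw [TensorProduct.smul_tmul', map_smul]
    congr 1
    module

theorem symZero_aeval (p : ℂ[X]) : symZero (aeval tPlus p) = curZero p := by
  apply Subtype.ext
  apply Subtype.ext
  change _ ⊗ₜ[ℂ] h = _ ⊗ₜ[ℂ] h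
  rw [invert_aeval_tPlus, ← two_smul ℂ (aeval tPlus p), smul_smul]
  norm_num

variable (φ : Module.Dual ℂ LtwZero)

local notation "𝕄" => Universal LtwPos LtwZero φ
local notation "v₀" => vacuum LtwPos LtwZero φ

/-- The projection onto the highest weight space. -/
theorem exists_vacuum_projection : ∃ χ : 𝕄 →ₗ[ℂ] ℂ, χ v₀ = 1 ∧
    ∀ m, χ (ι (cur h 1) • m) = φ (curZero 1) * χ m := by
  let b := Module.Basis.ofVectorSpace ℂ ℂ[T;T⁻¹]
  -- The Verma realization concerns the full loop algebra, so `φ` is first extended to all Laurent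
  -- polynomials by symmetrization.
  let ψ : ℂ[T;T⁻¹] →ₗ[ℂ] ℂ := φ ∘ₗ symZero
  have hψ : ∀ p, ψ (aeval tPlus p) = φ (curZero p) := fun p => by
    rw [← symZero_aeval]; rfl
  let ρ := (Verma.action b ψ).comp Ltw.incl
  have hρe : ∀ p, ρ (cur e p) = Verma.E b ψ (aeval tPlus p) := fun p =>
    Verma.action_tmul_e b ψ _
  have hρh : ∀ p, ρ (cur h p) = Verma.H b ψ (aeval tPlus p) := fun p =>
    Verma.action_tmul_h b ψ _
  obtain ⟨π, h1, h2⟩ := exists_universal_map (P := LtwPos) (φ := φ) ρ (w₀ := 1)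
    (fun x hx => by
      obtain ⟨p, rfl⟩ := exists_eq_cur_of_mem_twistedPart hx
      rw [hρe, Verma.E_one])
    (fun z => by
      obtain ⟨p, rfl⟩ := exists_eq_curZero z
      rw [coe_curZero, hρh, Verma.H_one, hψ])
  refine ⟨(MvPolynomial.aeval (fun _ => (0 : ℂ))).toLinearMap ∘ₗ π, ?_, fun m => ?_⟩
  · simp [h1]
  · have h0 : ∀ {κ : Type} (y : MvPolynomial κ ℂ),
        MvPolynomial.aeval (fun _ => (0 : ℂ)) y = MvPolynomial.constantCoeff y := fun y => by
      rw [MvPolynomial.aeval_zero']; rfl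
    rw [LinearMap.comp_apply, LinearMap.comp_apply, AlgHom.toLinearMap_apply,
      AlgHom.toLinearMap_apply, h0, h0, h2, UniversalEnvelopingAlgebra.lift_ι_apply, hρh, map_one,
      Verma.constantCoeff_H_one, ← map_one (aeval (R := ℂ) tPlus), hψ]

/-- The span of the vectors obtained from the highest weight vector by applying `k` lowering
operators. -/
def lowered : ℕ → Submodule ℂ 𝕄
  | 0 => ℂ ∙ v₀
  | k + 1 => Submodule.span ℂ {y | ∃ p : ℂ[X], ∃ m ∈ lowered k, y = ι (cur f p) • m}

variable {φ}

theorem f_smul_mem_lowered {k : ℕ} (p : ℂ[X]) {m : 𝕄} (hm : m ∈ lowered φ k) :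
    ι (cur f p) • m ∈ lowered φ (k + 1) :=
  Submodule.subset_span ⟨p, m, hm, rfl⟩

theorem h_smul_vacuum (q : ℂ[X]) : ι (cur h q) • v₀ = φ (curZero q) • v₀ :=
  ι_smul_vacuum (curZero q)

theorem e_smul_vacuum (q : ℂ[X]) : ι (cur e q) • v₀ = 0 := ι_smul_vacuum_of_mem (cur_e_mem q)

theorem h_smul_f_smul (p q : ℂ[X]) (m : 𝕄) : ι (cur h p) • ι (cur f q) • m =
    ι (cur f q) • ι (cur h p) • m + (-2 : ℂ) • ι (cur f (p * q)) • m := by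
  rw [ι_smul_ι_smul, lie_cur_h_f, map_smul, smul_assoc]

theorem h_smul_mem_lowered {k : ℕ} (q : ℂ[X]) {m : 𝕄} (hm : m ∈ lowered φ k) :
    ι (cur h q) • m ∈ lowered φ k := by
  induction k generalizing m with
  | zero =>
    obtain ⟨c, rfl⟩ := Submodule.mem_span_singleton.1 hm
    rw [smul_comm, h_smul_vacuum]
    exact Submodule.smul_mem _ _ (Submodule.smul_mem _ _ (Submodule.mem_span_singleton_self _))
  | succ k ih =>
    induction hm using Submodule.span_induction with
    | mem y hy =>
      obtain ⟨p, m, hm, rfl⟩ := hy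
      rw [h_smul_f_smul]
      exact add_mem (f_smul_mem_lowered p (ih hm))
        (Submodule.smul_mem _ _ (f_smul_mem_lowered _ hm))
    | zero => rw [smul_zero]; exact zero_mem _
    | add y z _ _ hy hz => rw [smul_add]; exact add_mem hy hz
    | smul c y _ hy => rw [smul_comm]; exact Submodule.smul_mem _ _ hy

theorem e_smul_mem_lowered {k : ℕ} (q : ℂ[X]) {m : 𝕄} (hm : m ∈ lowered φ (k + 1)) :
    ι (cur e q) • m ∈ lowered φ k := by
  induction k generalizing m with
  | zero =>
    induction hm using Submodule.span_induction with
    | mem y hy =>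
      obtain ⟨p, m, hm, rfl⟩ := hy
      rw [ι_smul_ι_smul, lie_cur_e_f]
      refine add_mem ?_ (h_smul_mem_lowered _ hm)
      obtain ⟨c, rfl⟩ := Submodule.mem_span_singleton.1 hm
      rw [smul_comm (ι (cur e q)) c, e_smul_vacuum, smul_zero, smul_zero]
      exact zero_mem _
    | zero => rw [smul_zero]; exact zero_mem _
    | add y z _ _ hy hz => rw [smul_add]; exact add_mem hy hz
    | smul c y _ hy => rw [smul_comm]; exact Submodule.smul_mem _ _ hy
  | succ k ih =>
    induction hm using Submodule.span_induction with
    | mem y hy =>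
      obtain ⟨p, m, hm, rfl⟩ := hy
      rw [ι_smul_ι_smul, lie_cur_e_f]
      exact add_mem (f_smul_mem_lowered p (ih hm)) (h_smul_mem_lowered _ hm)
    | zero => rw [smul_zero]; exact zero_mem _
    | add y z _ _ hy hz => rw [smul_add]; exact add_mem hy hz
    | smul c y _ hy => rw [smul_comm]; exact Submodule.smul_mem _ _ hy

theorem h_one_smul_of_mem_lowered {k : ℕ} {m : 𝕄} (hm : m ∈ lowered φ k) :
    ι (cur h 1) • m = (φ (curZero 1) - 2 * k) • m := by
  induction k generalizing m with
  | zero =>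
    obtain ⟨c, rfl⟩ := Submodule.mem_span_singleton.1 hm
    rw [smul_comm, h_smul_vacuum, smul_comm]
    simp
  | succ k ih =>
    induction hm using Submodule.span_induction with
    | mem y hy =>
      obtain ⟨p, m, hm, rfl⟩ := hy
      rw [h_smul_f_smul, ih hm, one_mul]
      push_cast
      rw [smul_comm (ι (cur f p)), ← add_smul]
      congr 1
      ring
    | zero => rw [smul_zero, smul_zero]
    | add y z _ _ hy hz => rw [smul_add, hy, hz, smul_add]
    | smul c y _ hy => rw [smul_comm, hy, smul_comm]

/-- The sum contains the generator and is stable under `e`, `f` and `h`; no independence of the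
summands is needed. -/
theorem iSup_lowered : ⨆ k, lowered φ k = ⊤ := by
  rw [eq_top_iff]
  intro m _
  obtain ⟨u, rfl⟩ := exists_eq_smul_vacuum m
  refine smul_mem_of_ι_smul_mem _ (fun x m hm => ?_) u
    (Submodule.mem_iSup_of_mem 0 (Submodule.mem_span_singleton_self _))
  obtain ⟨p, q, r, rfl⟩ := exists_eq_cur x
  induction hm using Submodule.iSup_induction' with
  | mem k m hm =>
    rw [map_add, map_add, add_smul, add_smul]
    refine add_mem (add_mem ?_ (Submodule.mem_iSup_of_mem k (h_smul_mem_lowered q hm)))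
      (Submodule.mem_iSup_of_mem (k + 1) (f_smul_mem_lowered r hm))
    cases k with
    | zero =>
      obtain ⟨c, rfl⟩ := Submodule.mem_span_singleton.1 hm
      rw [smul_comm, e_smul_vacuum, smul_zero]
      exact zero_mem _
    | succ k => exact Submodule.mem_iSup_of_mem k (e_smul_mem_lowered p hm)
  | zero => rw [smul_zero]; exact zero_mem _
  | add y z _ _ hy hz => rw [smul_add]; exact add_mem hy hz

/-- A polynomial in `h` isolates the top weight component: it is `1` at the highest weight and
vanishes at the lower weights occurring in `m`. Being a module action, it preserves submodules. -/
theorem exists_aeval_smul_eq (m : 𝕄) : ∃ (q : ℂ[X]) (c : ℂ), q.eval (φ (curZero 1)) = 1 ∧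
    aeval (ι (cur h 1)) q • m = c • v₀ := by
  have hm : m ∈ ⨆ k, lowered φ k := iSup_lowered (φ := φ) ▸ Submodule.mem_top
  have hvac := fun q => aeval_smul_of_eigenvector (h_smul_vacuum (φ := φ) 1) q
  induction hm using Submodule.iSup_induction' with
  | mem k m hm =>
    cases k with
    | zero =>
      obtain ⟨c, rfl⟩ := Submodule.mem_span_singleton.1 hm
      exact ⟨1, c, by simp, by simp⟩
    | succ k =>
      have hk : (2 * (k + 1 : ℕ) : ℂ) ≠ 0 := by
        exact_mod_cast (by omega : 2 * (k + 1) ≠ 0)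
      refine ⟨C (2 * (k + 1 : ℕ) : ℂ)⁻¹ * (X - C (φ (curZero 1) - 2 * (k + 1 : ℕ))), 0, ?_, ?_⟩
      · rw [eval_mul, eval_C, eval_sub, eval_X, eval_C, sub_sub_cancel, inv_mul_cancel₀ hk]
      · rw [aeval_smul_of_eigenvector (h_one_smul_of_mem_lowered hm)]
        simp
  | zero => exact ⟨1, 0, by simp, by simp⟩
  | add y z _ _ hy hz =>
    obtain ⟨q, c, hq, hc⟩ := hy
    obtain ⟨q', c', hq', hc'⟩ := hz
    refine ⟨q * q', c + c', by rw [eval_mul, hq, hq', one_mul], ?_⟩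
    rw [smul_add, map_mul, mul_smul _ _ z, hc', ← map_mul, mul_comm q, map_mul, mul_smul, hc,
      smul_comm _ c, hvac, hq', smul_comm _ c', hvac, hq, add_smul, one_smul]

variable (φ)

/-- The sum of all proper submodules of the universal highest weight module is proper. -/
theorem vacuum_notMem_maximalSubmodule : v₀ ∉ maximalSubmodule LtwPos LtwZero φ := by
  obtain ⟨χ, hχ, hχh⟩ := exists_vacuum_projection φ
  have hχq := fun (q : ℂ[X]) (m : 𝕄) => apply_aeval_smul χ hχh q m
  -- If `m` lies in a submodule `N`, so does the top component `χ (u • m) • v₀` of `u • m`. A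
  -- nonzero coefficient would put `v₀` in `N` and force `N = ⊤`.
  have hle : maximalSubmodule LtwPos LtwZero φ ≤ largestInKer χ := by
    refine sSup_le fun N hN m hm u => ?_
    obtain ⟨q, c, hq, hc⟩ := exists_aeval_smul_eq (u • m)
    have hχc : χ (u • m) = c := by
      have := hχq q (u • m)
      rw [hc, map_smul, hχ, hq, one_mul, smul_eq_mul, mul_one] at this
      exact this.symm
    by_contra hne
    rw [hχc] at hne
    refine hN (eq_top_of_vacuum_mem ?_)
    have hmem : c • v₀ ∈ N := hc ▸ N.smul_mem _ (N.smul_mem u hm)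
    rw [← algebraMap_smul U c v₀] at hmem
    have := N.smul_mem (algebraMap ℂ U c⁻¹) hmem
    rwa [algebraMap_smul, algebraMap_smul, smul_smul, inv_mul_cancel₀ hne, one_smul] at this
  intro hv
  have := hle hv 1
  rw [one_smul, hχ] at this
  exact one_ne_zero this

end Nonzero

end TwistedLoop

namespace TwistedLoop

open Polynomial

attribute [local instance] LieRing.ofAssociativeRing

/-! ### Finite-dimensional simple modules have highest weights that are sums of evaluations -/

/-- The operators of the current algebra in a representation of the twisted loop algebra. -/
def CurrentRep.ofLieHom {W : Type*} [AddCommGroup W] [Module ℂ W]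
    (ρ : Ltw →ₗ⁅ℂ⁆ Module.End ℂ W) : CurrentRep W where
  E := (ρ : Ltw →ₗ[ℂ] Module.End ℂ W) ∘ₗ cur e
  F := (ρ : Ltw →ₗ[ℂ] Module.End ℂ W) ∘ₗ cur f
  H := (ρ : Ltw →ₗ[ℂ] Module.End ℂ W) ∘ₗ cur h
  E_mul_F p q := by
    have := ρ.map_lie (cur e p) (cur f q)
    rw [lie_cur_e_f, LieRing.of_associative_ring_bracket] at this
    exact sub_eq_iff_eq_add'.1 this.symm
  H_mul_E p q := by
    have := ρ.map_lie (cur h p) (cur e q)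
    rw [lie_cur_h_e, LieRing.of_associative_ring_bracket, map_smul] at this
    exact sub_eq_iff_eq_add'.1 this.symm
  H_mul_F p q := by
    have := ρ.map_lie (cur h p) (cur f q)
    rw [lie_cur_h_f, LieRing.of_associative_ring_bracket, map_smul] at this
    exact sub_eq_iff_eq_add'.1 this.symm
  H_mul_H p q := by
    have := ρ.map_lie (cur h p) (cur h q)
    rw [lie_cur_h_h, LieRing.of_associative_ring_bracket, map_zero] at this
    exact sub_eq_zero.1 this.symm

/-- The representation of a Lie algebra on a module over its universal enveloping algebra. -/
def lieHomOfModule (A M : Type*) [LieRing A] [LieAlgebra ℂ A] [AddCommGroup M] [Module ℂ M]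
    [Module (UniversalEnvelopingAlgebra ℂ A) M]
    [IsScalarTower ℂ (UniversalEnvelopingAlgebra ℂ A) M] :
    A →ₗ⁅ℂ⁆ Module.End ℂ M :=
  (Algebra.lsmul ℂ ℂ M : UniversalEnvelopingAlgebra ℂ A →ₐ[ℂ] Module.End ℂ M).toLieHom.comp
    (UniversalEnvelopingAlgebra.ι ℂ)

theorem isHighestWeight_of_generator {M : Type*} [AddCommGroup M] [Module ℂ M]
    [Module (UniversalEnvelopingAlgebra ℂ Ltw) M]
    [IsScalarTower ℂ (UniversalEnvelopingAlgebra ℂ Ltw) M] {v : M} {φ : ℂ[X] →ₗ[ℂ] ℂ} (hv : v ≠ 0)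
    (he : ∀ p, UniversalEnvelopingAlgebra.ι ℂ (cur e p) • v = 0)
    (hh : ∀ p, UniversalEnvelopingAlgebra.ι ℂ (cur h p) • v = φ p • v)
    (hgen : ∀ y : M, ∃ u : UniversalEnvelopingAlgebra ℂ Ltw, y = u • v) :
    (CurrentRep.ofLieHom (lieHomOfModule Ltw M)).IsHighestWeight v φ where
  ne_zero := hv
  E_apply := he
  H_apply := hh
  cyclic W hv hW := by
    rw [eq_top_iff]
    intro y _
    obtain ⟨u, rfl⟩ := hgen y
    refine smul_mem_of_ι_smul_mem W (fun x m hm => ?_) u hv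
    obtain ⟨p, q, r, rfl⟩ := exists_eq_cur x
    rw [map_add, map_add, add_smul, add_smul]
    exact add_mem (add_mem (hW p m hm).1 (hW q m hm).2.2) (hW r m hm).2.1

theorem isHighestWeight_simple (φ : Module.Dual ℂ LtwZero) :
    (CurrentRep.ofLieHom (lieHomOfModule Ltw (V φ))).IsHighestWeight
      ((maximalSubmodule LtwPos LtwZero φ).mkQ (vacuum LtwPos LtwZero φ)) (φ ∘ₗ curZero) := by
  refine isHighestWeight_of_generator
    (fun h0 => vacuum_notMem_maximalSubmodule φ ((Submodule.Quotient.mk_eq_zero _).1 h0))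
    (fun p => ?_) (fun p => ?_) (fun y => ?_)
  · rw [← map_smul, e_smul_vacuum, map_zero]
  · rw [← map_smul, h_smul_vacuum]
    rfl
  · obtain ⟨m, rfl⟩ := Submodule.mkQ_surjective _ y
    obtain ⟨u, rfl⟩ := exists_eq_smul_vacuum m
    exact ⟨u, map_smul _ _ _⟩

theorem exists_add_inv_eq (c : ℂ) : ∃ α : ℂˣ, (α : ℂ) + (α : ℂ)⁻¹ = c := by
  -- `α` is a root of `x ^ 2 - c * x + 1`; `s` is a square root of its discriminant, and the other
  -- root is `α⁻¹`.
  obtain ⟨s, hs⟩ := IsAlgClosed.exists_pow_nat_eq (c ^ 2 - 4) (n := 2) (by norm_num)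
  have h1 : (c + s) / 2 * ((c - s) / 2) = 1 := by linear_combination -hs / 4
  have h2 : (c - s) / 2 * ((c + s) / 2) = 1 := by rw [mul_comm, h1]
  refine ⟨⟨_, _, h1, h2⟩, ?_⟩
  change (c + s) / 2 + ((c + s) / 2)⁻¹ = c
  rw [inv_eq_of_mul_eq_one_right h1]
  ring

theorem exists_fin_sum_eq (S : Finset ℂ) (n : ℂ → ℕ) : ∃ (k : ℕ) (α : Fin k → ℂˣ), ∀ a : ℕ,
    ∑ c ∈ S, (n c : ℂ) * c ^ a = ∑ i, ((α i : ℂ) + (α i : ℂ)⁻¹) ^ a := by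
  choose β hβ using exists_add_inv_eq
  -- Each point `c` is listed `n c` times.
  let ε := Fintype.equivFin ((c : S) × Fin (n c))
  refine ⟨_, fun i => β (ε.symm i).1, fun a => ?_⟩
  simp only [hβ]
  rw [Equiv.sum_comp ε.symm (fun x => ((x.1 : ℂ)) ^ a), Fintype.sum_sigma,
    ← Finset.sum_coe_sort S]
  simp

theorem exists_sum_of_finiteDimensional (φ : Module.Dual ℂ LtwZero)
    [FiniteDimensional ℂ (V φ)] : ∃ (n : ℕ) (α : Fin n → ℂˣ), ∀ a : ℕ,
      φ (w a) = ∑ i, ((α i : ℂ) + (α i : ℂ)⁻¹) ^ a := by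
  obtain ⟨S, n, hS⟩ := (isHighestWeight_simple φ).exists_eq_sum_eval
  obtain ⟨k, α, hα⟩ := exists_fin_sum_eq S n
  refine ⟨k, α, fun a => ?_⟩
  rw [← hα, ← curZero_X_pow]
  simpa using hS (X ^ a)

/-! ### Tensor products of evaluation modules -/

/-- The tensor product of two representations. -/
def tensorRep {A W W' : Type*} [LieRing A] [LieAlgebra ℂ A] [AddCommGroup W] [Module ℂ W]
    [AddCommGroup W'] [Module ℂ W'] (ρ : A →ₗ⁅ℂ⁆ Module.End ℂ W) (σ : A →ₗ⁅ℂ⁆ Module.End ℂ W') :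
    A →ₗ⁅ℂ⁆ Module.End ℂ (W ⊗[ℂ] W') where
  toFun x := (ρ x).rTensor W' + (σ x).lTensor W
  map_add' x y := by
    rw [map_add, map_add, LinearMap.rTensor_add, LinearMap.lTensor_add]
    abel
  map_smul' c x := by
    rw [map_smul, map_smul, LinearMap.rTensor_smul, LinearMap.lTensor_smul, smul_add,
      RingHom.id_apply]
  map_lie' {x y} := by
    apply TensorProduct.ext'
    intro m m'
    simp only [LieHom.map_lie, LieRing.of_associative_ring_bracket, LinearMap.add_apply,
      LinearMap.sub_apply, Module.End.mul_apply, LinearMap.rTensor_tmul, LinearMap.lTensor_tmul,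
      map_add, TensorProduct.sub_tmul, TensorProduct.tmul_sub]
    abel

theorem tensorRep_tmul {A W W' : Type*} [LieRing A] [LieAlgebra ℂ A] [AddCommGroup W] [Module ℂ W]
    [AddCommGroup W'] [Module ℂ W'] (ρ : A →ₗ⁅ℂ⁆ Module.End ℂ W) (σ : A →ₗ⁅ℂ⁆ Module.End ℂ W')
    (x : A) (m : W) (m' : W') :
    tensorRep ρ σ x (m ⊗ₜ m') = ρ x m ⊗ₜ m' + m ⊗ₜ σ x m' := rfl

/-- Evaluation of Laurent polynomials at a nonzero complex number. -/
def evalAt (α : ℂˣ) : ℂ[T;T⁻¹] →ₐ[ℂ] ℂ where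
  __ := LaurentPolynomial.eval₂ (RingHom.id ℂ) α
  commutes' c := by
    change LaurentPolynomial.eval₂ (RingHom.id ℂ) α (algebraMap ℂ ℂ[T;T⁻¹] c) = c
    rw [← LaurentPolynomial.C_eq_algebraMap, LaurentPolynomial.eval₂_C]
    rfl

theorem evalAt_aeval_tPlus (α : ℂˣ) (p : ℂ[X]) :
    evalAt α (aeval tPlus p) = p.eval ((α : ℂ) + (α : ℂ)⁻¹) := by
  have hT : evalAt α tPlus = (α : ℂ) + (α : ℂ)⁻¹ := by
    change LaurentPolynomial.eval₂ (RingHom.id ℂ) α tPlus = _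
    rw [tPlus, map_add, LaurentPolynomial.eval₂_T, LaurentPolynomial.eval₂_T]
    simp
  rw [← Polynomial.aeval_algHom_apply, hT, Polynomial.coe_aeval_eq_eval]

/-- The natural representation of `sl₂` evaluated at `t = α`, as a linear map. -/
def evalRepₗ (α : ℂˣ) : Loop sl2 →ₗ[ℂ] Module.End ℂ (Fin 2 → ℂ) :=
  TensorProduct.lift <| LinearMap.mk₂ ℂ (fun P x => evalAt α P • Matrix.toLin' x.val)
    (fun P Q x => by rw [map_add, add_smul])
    (fun c P x => by rw [map_smul, smul_assoc])
    (fun P x y => by rw [← smul_add, ← map_add]; rfl)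
    (fun c P x => by rw [smul_comm c, ← map_smul Matrix.toLin' c]; rfl)

theorem evalRepₗ_tmul (α : ℂˣ) (P : ℂ[T;T⁻¹]) (x : sl2) :
    evalRepₗ α (P ⊗ₜ x) = evalAt α P • Matrix.toLin' x.val := rfl

/-- The natural representation of `sl₂` evaluated at `t = α`. -/
def evalRep (α : ℂˣ) : Loop sl2 →ₗ⁅ℂ⁆ Module.End ℂ (Fin 2 → ℂ) where
  __ := evalRepₗ α
  map_lie' {x y} := by
    change evalRepₗ α ⁅x, y⁆ = ⁅evalRepₗ α x, evalRepₗ α y⁆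
    rw [LieRing.of_associative_ring_bracket]
    induction x using TensorProduct.induction_on with
    | zero => rw [zero_lie y]; simp
    | add x z hx hz => rw [add_lie x z y, map_add, map_add, hx, hz, add_mul, mul_add]; abel
    | tmul P x =>
      induction y using TensorProduct.induction_on with
      | zero => rw [lie_zero (P ⊗ₜ[ℂ] x)]; simp
      | add y z hy hz =>
        rw [lie_add (P ⊗ₜ[ℂ] x), map_add, map_add, hy, hz, add_mul, mul_add]; abel
      | tmul Q y =>
        rw [LieAlgebra.ExtendScalars.bracket_tmul, evalRepₗ_tmul, evalRepₗ_tmul, evalRepₗ_tmul,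
          LieAlgebra.SpecialLinear.sl_bracket, map_sub, Matrix.toLin'_mul, Matrix.toLin'_mul,
          map_mul]
        simp only [smul_mul_smul_comm, Module.End.mul_eq_comp]
        rw [smul_sub, mul_comm (evalAt α Q)]

theorem evalRep_cur (α : ℂˣ) (x : sl2) (p : ℂ[X]) :
    evalRep α (cur x p) = p.eval ((α : ℂ) + (α : ℂ)⁻¹) • Matrix.toLin' x.val := by
  rw [← evalAt_aeval_tPlus]
  rfl

/-- Each natural module evaluated at `α i` has a highest weight vector on which `p ⊗ h` acts by `p
(α i + (α i)⁻¹)`, and weights add under tensor products. The empty product is the trivial module. -/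
theorem exists_highestWeight_rep (n : ℕ) (α : Fin n → ℂˣ) :
    ∃ (W : Type) (_ : AddCommGroup W) (_ : Module ℂ W) (_ : FiniteDimensional ℂ W)
      (ρ : Ltw →ₗ⁅ℂ⁆ Module.End ℂ W) (w₀ : W), w₀ ≠ 0 ∧ (∀ p, ρ (cur e p) w₀ = 0) ∧
        ∀ p : ℂ[X], ρ (cur h p) w₀ = (∑ i, p.eval ((α i : ℂ) + (α i : ℂ)⁻¹)) • w₀ := by
  induction n with
  | zero => exact ⟨ℂ, inferInstance, inferInstance, inferInstance, 0, 1, one_ne_zero,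
      fun p => rfl, fun p => by simp⟩
  | succ n ih =>
    obtain ⟨W, _, _, _, ρ, w₀, h0, he, hh⟩ := ih fun i => α i.succ
    have hσe : ∀ p, (evalRep (α 0)).comp Ltw.incl (cur e p) (Pi.single 0 1) = 0 := by
      intro p
      change evalRep (α 0) (cur e p) _ = _
      rw [evalRep_cur]
      ext i
      fin_cases i <;> simp [e]
    have hσh : ∀ p : ℂ[X], (evalRep (α 0)).comp Ltw.incl (cur h p) (Pi.single 0 1) =
        p.eval ((α 0 : ℂ) + (α 0 : ℂ)⁻¹) • Pi.single 0 1 := by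
      intro p
      change evalRep (α 0) (cur h p) _ = _
      rw [evalRep_cur]
      ext i
      fin_cases i <;> simp [h]
    refine ⟨(Fin 2 → ℂ) ⊗[ℂ] W, inferInstance, inferInstance, inferInstance,
      tensorRep ((evalRep (α 0)).comp Ltw.incl) ρ, Pi.single 0 1 ⊗ₜ w₀, ?_, fun p => ?_,
      fun p => ?_⟩
    · intro h
      -- Contracting the first factor with its coordinate `0` returns `w₀`, so the pure tensor is
      -- nonzero.
      have := congrArg (fun z => TensorProduct.lid ℂ W ((LinearMap.proj 0).rTensor W z)) h
      simp [h0] at this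
    · rw [tensorRep_tmul, hσe, he, TensorProduct.zero_tmul, TensorProduct.tmul_zero, add_zero]
    · rw [tensorRep_tmul, hσh, hh, Fin.sum_univ_succ, add_smul, TensorProduct.tmul_smul]
      rfl

theorem finiteDimensional_of_eq_sum (φ : Module.Dual ℂ LtwZero) {n : ℕ} (α : Fin n → ℂˣ)
    (hα : ∀ a : ℕ, φ (w a) = ∑ i, ((α i : ℂ) + (α i : ℂ)⁻¹) ^ a) :
    FiniteDimensional ℂ (V φ) := by
  obtain ⟨W, _, _, _, ρ, w₀, h0, he, hh⟩ := exists_highestWeight_rep n α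
  have hφ : ∀ p : ℂ[X], φ (curZero p) = ∑ i, p.eval ((α i : ℂ) + (α i : ℂ)⁻¹) := by
    intro p
    induction p using Polynomial.induction_on' with
    | add p q hp hq => simp only [map_add, hp, hq, eval_add, Finset.sum_add_distrib]
    | monomial a c =>
      rw [← C_mul_X_pow_eq_monomial, ← smul_eq_C_mul, map_smul, map_smul, curZero_X_pow, hα,
        smul_eq_mul, Finset.mul_sum]
      simp
  refine finiteDimensional_simple ρ h0 (fun x hx => ?_) fun z => ?_
  · obtain ⟨p, rfl⟩ := exists_eq_cur_of_mem_twistedPart hx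
    exact he p
  · obtain ⟨p, rfl⟩ := exists_eq_curZero z
    rw [coe_curZero, hh, hφ]

end TwistedLoop

end

theorem mainTheorem3 (φ : Module.Dual ℂ TwistedLoop.LtwZero) :
    FiniteDimensional ℂ (TwistedLoop.V φ) ↔
      ∃ (n : ℕ) (α : Fin n → ℂˣ), ∀ a : ℕ,
        φ (TwistedLoop.w a) = ∑ i, ((α i : ℂ) + (α i : ℂ)⁻¹) ^ a :=
  ⟨fun _ => TwistedLoop.exists_sum_of_finiteDimensional φ,
    fun ⟨_, α, hα⟩ => TwistedLoop.finiteDimensional_of_eq_sum φ α hα⟩
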